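/- Let $\Omega=[a,b]$ with $a<b$, let $k,i\ge 0$ be integers, let $\nu$ be a real number, and let $\theta_1,\dots,\theta_i$ be real numbers with $\theta_j\neq\frac12$ for $1\le j\le i$. For a partition $a=x_{1/2}<x_{3/2}<\dots<x_{N+1/2}=b$ with cells $I_j=[x_{j-1/2},x_{j+1/2}]$ and mesh size $h=\max_j|I_j|$, let $V_h=\{v\in L^2(\Omega): v|_{I_j}\in P^k(I_j)\ \forall j\}$, where $P^k$ denotes the polynomials of degree at most $k$, and let $Z_h=\{v\in V_h:\langle v,1\rangle=0\}$, where $\langle\cdot,\cdot\rangle$ and $\|\cdot\|$ are the inner product and the norm of $L^2(\Omega)$. Let $\Pi_0$ be the $L^2$-orthogonal projection onto $V_h$. For $v\in V_h$, let $v^-_{j+1/2}$ and $v^+_{j+1/2}$ ($1\le j\le N$) be the left and right limits at $x_{j+1/2}$, where the points $a$ and $b$ are identified periodically, and let $[v]=v^+-v^-$. For real $\theta$ the operator $D_{h,\theta}:V_h\to V_h$ is defined by $$\langle D_{h,\theta}w_h,v_h\rangle=-\sum_{j=1}^N\int_{I_j}w_h\,\partial_xv_h\,dx-\sum_{j=1}^N\bigl(\theta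 w_h^-+(1-\theta)w_h^+\bigr)_{j+1/2}[v_h]_{j+1/2}\qquad\forall\, w_h,v_h\in V_h .$$ Then there is a constant $C>0$, depending only on $a,b,k,i,\nu,\theta_1,\dots,\theta_i$, such that for every such partition that is quasi-uniform in the sense that $|I_j|\le\nu|I_l|$ for all $j,l$, the following holds. Each $D_{h,\theta_j}$, $1\le j\le i$, maps $Z_h$ bijectively onto $Z_h$; write $D_{h,\theta_j}^{-1}:Z_h\to Z_h$ for the inverse. For every $(b-a)$-periodic function $w:\mathbb R\to\mathbb R$ of class $C^{k+1+i}$ with $\int_a^bw\,dx=0$ one has $\Pi_0\partial_x^iw\in Z_h$ and $$\bigl\|w-D_{h,\theta_i}^{-1}D_{h,\theta_{i-1}}^{-1}\cdots D_{h,\theta_1}^{-1}\Pi_0\partial_x^iw\bigr\|\le C\,\|w\|_{k+1+i}\,h^{k+1},$$ where $\|w\|_m=\bigl(\sum_{l=0}^m\|\partial_x^lw\|^2\bigr)^{1/2}$ is the Sobolev norm of $H^m(\Omega)$. For $i=0$ the composition of inverses is the identity. -/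

import Mathlib

namespace PeriodicDG

open Polynomial

noncomputable section

/-- A partition `a = x_0 < x_1 < ⋯ < x_N = b` of the interval `[a, b]` into `N` cells. -/
structure Mesh (a b : ℝ) (N : ℕ) where
  node : Fin (N + 1) → ℝ
  node_strictMono : StrictMono node
  node_zero : node 0 = a
  node_last : node (Fin.last N) = b

variable {a b : ℝ} {N : ℕ}

/-- Left endpoint of the cell `I_j`. -/
def Mesh.left (M : Mesh a b N) (j : Fin N) : ℝ := M.node j.castSucc

/-- Right endpoint of the cell `I_j`. -/
def Mesh.right (M : Mesh a b N) (j : Fin N) : ℝ := M.node j.succ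

/-- Length of the cell `I_j`. -/
def Mesh.cellLength (M : Mesh a b N) (j : Fin N) : ℝ := M.right j - M.left j

/-- The mesh size, i.e. the largest cell length. -/
def Mesh.h (M : Mesh a b N) : ℝ := ⨆ j : Fin N, M.cellLength j

/-- Quasi-uniformity with constant `ν`: the ratio of any two cell lengths is at most `ν`. -/
def Mesh.QuasiUniform (M : Mesh a b N) (ν : ℝ) : Prop :=
  ∀ i j : Fin N, M.cellLength i ≤ ν * M.cellLength j

/-- The piecewise polynomial function on `(a, b]` equal to `P j` on the cell `I_j`. -/
def Mesh.pw (M : Mesh a b N) (P : Fin N → ℝ[X]) (x : ℝ) : ℝ :=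
  ∑ j : Fin N, Set.indicator (Set.Ioc (M.left j) (M.right j)) (fun y => (P j).eval y) x

/-- The discontinuous finite element space `V_h`: on each of the `N` cells a polynomial of
degree at most `k`, with no continuity across the interfaces. -/
abbrev DGSpace (N k : ℕ) : Type := Fin N → Polynomial.degreeLT ℝ (k + 1)

variable {k : ℕ}

/-- The element `v` of `V_h` as a real function. -/
def Mesh.toFun (M : Mesh a b N) (v : DGSpace N k) : ℝ → ℝ := M.pw fun j => (v j : ℝ[X])

/-- The cellwise derivative `∂_x v`, as a real function. -/
def Mesh.derivFun (M : Mesh a b N) (v : DGSpace N k) : ℝ → ℝ :=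
  M.pw fun j => derivative (v j : ℝ[X])

/-- The `L²(a, b)` inner product. -/
def ip (a b : ℝ) (f g : ℝ → ℝ) : ℝ := ∫ x in a..b, f x * g x

/-- The `L²(a, b)` norm. -/
def l2norm (a b : ℝ) (f : ℝ → ℝ) : ℝ := √(ip a b f f)

/-- The Sobolev norm of `H^m(a, b)` (for functions of class `C^m`). -/
def sobolevNorm (a b : ℝ) (m : ℕ) (f : ℝ → ℝ) : ℝ :=
  √(∑ l ∈ Finset.range (m + 1), ip a b (iteratedDeriv l f) (iteratedDeriv l f))

/-- The trace `v⁻` at the right end of the cell `I_j` (limit from the left). -/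
def Mesh.traceL (M : Mesh a b N) (v : DGSpace N k) (j : Fin N) : ℝ :=
  (v j : ℝ[X]).eval (M.right j)

/-- The trace `v⁺` at the right end of the cell `I_j` (limit from the right). The cell to the right
is the next one in the cyclic order: the two ends of `[a, b]` form one interface. -/
def Mesh.traceR (M : Mesh a b N) (v : DGSpace N k) (j : Fin N) : ℝ :=
  (v (finRotate N j) : ℝ[X]).eval (M.left (finRotate N j))

/-- The jump `[v] = v⁺ - v⁻` at the right end of the cell `I_j`. -/
def Mesh.jump (M : Mesh a b N) (v : DGSpace N k) (j : Fin N) : ℝ := M.traceR v j - M.traceL v j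

/-- The numerical flux `θ w⁻ + (1 - θ) w⁺` at the right end of the cell `I_j`. -/
def Mesh.flux (M : Mesh a b N) (θ : ℝ) (w : DGSpace N k) (j : Fin N) : ℝ :=
  θ * M.traceL w j + (1 - θ) * M.traceR w j

/-- The form `-⟨w, ∂_x v⟩ - ∑_j ŵ_{j+1/2} [v]_{j+1/2}`. -/
def Mesh.dgForm (M : Mesh a b N) (θ : ℝ) (w v : DGSpace N k) : ℝ :=
  -ip a b (M.toFun w) (M.derivFun v) - ∑ j : Fin N, M.flux θ w j * M.jump v j

open Classical in
/-- The element `z` of `V_h` with `⟨z, v⟩ = F v` for all `v ∈ V_h`. It exists and is unique when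
`F` is linear, see `Mesh.existsUnique_riesz`. -/
def Mesh.riesz (M : Mesh a b N) (F : DGSpace N k → ℝ) : DGSpace N k :=
  if H : ∃ z : DGSpace N k, ∀ v : DGSpace N k, ip a b (M.toFun z) (M.toFun v) = F v
  then H.choose else 0

/-- The operator `D_{h,θ} : V_h → V_h`, see `Mesh.ip_D`. -/
def Mesh.D (M : Mesh a b N) (θ : ℝ) (w : DGSpace N k) : DGSpace N k :=
  M.riesz fun v => M.dgForm θ w v

/-- The `L²` projection `Π₀` onto `V_h`, with polynomial degree `k`, see `Mesh.ip_proj`. -/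
def Mesh.proj (M : Mesh a b N) (k : ℕ) (f : ℝ → ℝ) : DGSpace N k :=
  M.riesz fun v => ip a b f (M.toFun v)

/-- The subspace `Z_h` of the elements of `V_h` that have mean zero. -/
def Mesh.Zh (M : Mesh a b N) (k : ℕ) : Set (DGSpace N k) :=
  {z | ip a b (M.toFun z) (fun _ => 1) = 0}

/-- The inverse of `D_{h,θ}` on `Z_h`. -/
def Mesh.Dinv (M : Mesh a b N) (θ : ℝ) : DGSpace N k → DGSpace N k :=
  Function.invFunOn (M.D θ) (M.Zh k)

/-- The composition `D_{h,θ_i}⁻¹ ⋯ D_{h,θ_1}⁻¹`, the inverse with parameter `θ_1` acting first. -/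
def Mesh.DinvIter (M : Mesh a b N) (θ : ℕ → ℝ) : ℕ → DGSpace N k → DGSpace N k
  | 0, z => z
  | i + 1, z => M.Dinv (θ (i + 1)) (M.DinvIter θ i z)

theorem Mesh.left_lt_right (M : Mesh a b N) (j : Fin N) : M.left j < M.right j :=
  M.node_strictMono Fin.castSucc_lt_succ

theorem Mesh.pw_eq (M : Mesh a b N) (P : Fin N → ℝ[X]) (j : Fin N) {x : ℝ}
    (hx : x ∈ Set.Ioc (M.left j) (M.right j)) : M.pw P x = (P j).eval x := by
  unfold Mesh.pw
  rw [Finset.sum_eq_single j]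
  · rw [Set.indicator_of_mem hx]
  · intro i _ hij
    apply Set.indicator_of_notMem
    intro hi
    rcases lt_or_gt_of_ne hij with h | h
    · have : M.right i ≤ M.left j := M.node_strictMono.monotone (by
        rw [Fin.le_def]; simpa using h)
      exact absurd hx.1 (not_lt.2 (hi.2.trans this))
    · have : M.right j ≤ M.left i := M.node_strictMono.monotone (by
        rw [Fin.le_def]; simpa using h)
      exact absurd hi.1 (not_lt.2 (hx.2.trans this))
  · simp

/-- An integral over `(a, b)` is the sum of the integrals over the cells. -/
theorem Mesh.integral_eq_sum (M : Mesh a b N) (F : ℝ → ℝ)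
    (hF : ∀ j, IntervalIntegrable F MeasureTheory.volume (M.left j) (M.right j)) :
    ∫ x in a..b, F x = ∑ j : Fin N, ∫ x in (M.left j)..(M.right j), F x := by
  let y : ℕ → ℝ := fun n => if h : n < N + 1 then M.node ⟨n, h⟩ else 0
  have hl : ∀ j : Fin N, y j = M.left j := fun j => by
    have : (j : ℕ) < N + 1 := by omega
    simp only [y, this, dif_pos]; rfl
  have hr : ∀ j : Fin N, y (j + 1) = M.right j := fun j => by
    have : (j : ℕ) + 1 < N + 1 := by omega
    simp only [y, this, dif_pos]; rfl
  have h0 : y 0 = a := by rw [← M.node_zero]; simp [y]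
  have hN : y N = b := by rw [← M.node_last]; simp [y, Fin.last]
  have := intervalIntegral.sum_integral_adjacent_intervals (f := F) (a := y) (n := N)
    (μ := MeasureTheory.volume) (fun n hn => by
      have := hF ⟨n, hn⟩
      rwa [← hl ⟨n, hn⟩, ← hr ⟨n, hn⟩] at this)
  rw [h0, hN] at this
  rw [← this, Finset.sum_range]
  exact Finset.sum_congr rfl fun j _ => by rw [hl, hr]

/-- The inner product of a piecewise polynomial with a continuous function, cell by cell. -/
theorem Mesh.ip_cont_pw (M : Mesh a b N) {f : ℝ → ℝ} (hf : Continuous f) (P : Fin N → ℝ[X]) :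
    ip a b f (M.pw P) = ∑ j : Fin N, ∫ x in (M.left j)..(M.right j), f x * (P j).eval x := by
  have key : ∀ j, Set.EqOn (fun x => f x * (P j).eval x) (fun x => f x * M.pw P x)
      (Set.uIoc (M.left j) (M.right j)) := fun j x hx => by
    rw [Set.uIoc_of_le (M.left_lt_right j).le] at hx
    simp only [M.pw_eq P j hx]
  unfold ip
  rw [M.integral_eq_sum]
  · refine Finset.sum_congr rfl fun j _ => ?_
    exact (intervalIntegral.integral_congr_ae (Filter.Eventually.of_forall fun x hx => key j hx)).symm
  · intro j
    exact ((hf.mul (P j).continuous).intervalIntegrable _ _).congr (key j)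

/-- The inner product of two piecewise polynomials, cell by cell. -/
theorem Mesh.ip_pw_pw (M : Mesh a b N) (P Q : Fin N → ℝ[X]) :
    ip a b (M.pw P) (M.pw Q) =
      ∑ j : Fin N, ∫ x in (M.left j)..(M.right j), (P j).eval x * (Q j).eval x := by
  have key : ∀ j, Set.EqOn (fun x => (P j).eval x * (Q j).eval x)
      (fun x => M.pw P x * M.pw Q x) (Set.uIoc (M.left j) (M.right j)) := fun j x hx => by
    rw [Set.uIoc_of_le (M.left_lt_right j).le] at hx
    simp only [M.pw_eq P j hx, M.pw_eq Q j hx]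
  unfold ip
  rw [M.integral_eq_sum]
  · refine Finset.sum_congr rfl fun j _ => ?_
    exact (intervalIntegral.integral_congr_ae (Filter.Eventually.of_forall fun x hx => key j hx)).symm
  · intro j
    exact (((P j).continuous.mul (Q j).continuous).intervalIntegrable _ _).congr (key j)

theorem integral_mul_add {f g g' : ℝ → ℝ} (hf : Continuous f) (hg : Continuous g)
    (hg' : Continuous g') (c d : ℝ) :
    ∫ x in c..d, f x * (g x + g' x) = (∫ x in c..d, f x * g x) + ∫ x in c..d, f x * g' x := by
  simp only [mul_add]
  exact intervalIntegral.integral_add ((hf.mul hg).intervalIntegrable c d)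
    ((hf.mul hg').intervalIntegrable c d)

/-- The `L²` inner product as a bilinear form on `V_h`. -/
def Mesh.ipForm (M : Mesh a b N) (k : ℕ) : DGSpace N k →ₗ[ℝ] DGSpace N k →ₗ[ℝ] ℝ :=
  LinearMap.mk₂ ℝ (fun z v => ip a b (M.toFun z) (M.toFun v))
    (fun z z' v => by
      simp only [Mesh.toFun, Mesh.ip_pw_pw, ← Finset.sum_add_distrib]
      refine Finset.sum_congr rfl fun j _ => ?_
      simpa [mul_comm] using integral_mul_add (v j : ℝ[X]).continuous (z j : ℝ[X]).continuous
        (z' j : ℝ[X]).continuous (M.left j) (M.right j))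
    (fun c z v => by
      simp [Mesh.toFun, Mesh.ip_pw_pw, Finset.mul_sum, mul_assoc])
    (fun z v v' => by
      simp only [Mesh.toFun, Mesh.ip_pw_pw, ← Finset.sum_add_distrib]
      refine Finset.sum_congr rfl fun j _ => ?_
      simpa using integral_mul_add (z j : ℝ[X]).continuous (v j : ℝ[X]).continuous
        (v' j : ℝ[X]).continuous (M.left j) (M.right j))
    (fun c z v => by
      simp [Mesh.toFun, Mesh.ip_pw_pw, Finset.mul_sum, mul_left_comm])

theorem Mesh.eq_zero_of_ip_self (M : Mesh a b N) (z : DGSpace N k)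
    (hz : ip a b (M.toFun z) (M.toFun z) = 0) : z = 0 := by
  rw [Mesh.toFun, Mesh.ip_pw_pw] at hz
  have hnn : ∀ j ∈ Finset.univ, 0 ≤ ∫ x in (M.left j)..(M.right j),
      (z j : ℝ[X]).eval x * (z j : ℝ[X]).eval x := fun j _ =>
    intervalIntegral.integral_nonneg (M.left_lt_right j).le fun x _ => mul_self_nonneg _
  rw [Finset.sum_eq_zero_iff_of_nonneg hnn] at hz
  funext j
  have hj := hz j (Finset.mem_univ j)
  have hc : Continuous fun x => (z j : ℝ[X]).eval x * (z j : ℝ[X]).eval x :=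
    (z j : ℝ[X]).continuous.mul (z j : ℝ[X]).continuous
  apply Subtype.ext
  show (z j : ℝ[X]) = 0
  apply Polynomial.eq_zero_of_infinite_isRoot
  refine (Set.Icc_infinite (M.left_lt_right j)).mono fun x hx => ?_
  by_contra hne
  have : 0 < ∫ x in (M.left j)..(M.right j), (z j : ℝ[X]).eval x * (z j : ℝ[X]).eval x :=
    intervalIntegral.integral_pos (M.left_lt_right j) hc.continuousOn
      (fun x _ => mul_self_nonneg _) ⟨x, hx, mul_self_pos.2 hne⟩
  exact this.ne' hj

/-- Every linear functional on `V_h` is represented by a unique element of `V_h`. -/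
theorem Mesh.existsUnique_riesz (M : Mesh a b N) (F : DGSpace N k →ₗ[ℝ] ℝ) :
    ∃! z : DGSpace N k, ∀ v : DGSpace N k, ip a b (M.toFun z) (M.toFun v) = F v := by
  have : Module.Finite ℝ (Polynomial.degreeLT ℝ (k + 1)) :=
    Module.Finite.equiv (Polynomial.degreeLTEquiv ℝ (k + 1)).symm
  have hinj : Function.Injective (M.ipForm k) := by
    rw [injective_iff_map_eq_zero]
    intro z hz
    exact M.eq_zero_of_ip_self z (by simpa [Mesh.ipForm] using LinearMap.congr_fun hz z)
  have hsurj : Function.Surjective (M.ipForm k) :=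
    (LinearMap.injective_iff_surjective_of_finrank_eq_finrank
      (Subspace.dual_finrank_eq (K := ℝ) (V := DGSpace N k)).symm).1 hinj
  obtain ⟨z, hz⟩ := hsurj F
  refine ⟨z, fun v => by rw [← hz]; rfl, fun z' hz' => hinj ?_⟩
  rw [hz]
  exact LinearMap.ext hz'

theorem Mesh.ip_riesz (M : Mesh a b N) (F : DGSpace N k →ₗ[ℝ] ℝ) (v : DGSpace N k) :
    ip a b (M.toFun (M.riesz F)) (M.toFun v) = F v := by
  have H := (M.existsUnique_riesz F).exists
  rw [Mesh.riesz, dif_pos H]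
  exact H.choose_spec v

/-- The variational identity that defines `D_{h,θ}`. -/
theorem Mesh.ip_D (M : Mesh a b N) (θ : ℝ) (w v : DGSpace N k) :
    ip a b (M.toFun (M.D θ w)) (M.toFun v) =
      -ip a b (M.toFun w) (M.derivFun v) - ∑ j : Fin N, M.flux θ w j * M.jump v j := by
  let F : DGSpace N k →ₗ[ℝ] ℝ :=
    { toFun := fun v => M.dgForm θ w v
      map_add' := fun u v => by
        have h1 : ip a b (M.toFun w) (M.derivFun (u + v)) =
            ip a b (M.toFun w) (M.derivFun u) + ip a b (M.toFun w) (M.derivFun v) := by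
          simp only [Mesh.toFun, Mesh.derivFun, Mesh.ip_pw_pw, ← Finset.sum_add_distrib]
          refine Finset.sum_congr rfl fun j _ => ?_
          simpa using integral_mul_add (w j : ℝ[X]).continuous
            (derivative (u j : ℝ[X])).continuous (derivative (v j : ℝ[X])).continuous
            (M.left j) (M.right j)
        have h2 : ∀ j, M.jump (u + v) j = M.jump u j + M.jump v j := fun j => by
          simp [Mesh.jump, Mesh.traceL, Mesh.traceR]; ring
        simp only [Mesh.dgForm, h1, h2, mul_add, Finset.sum_add_distrib]
        ring
      map_smul' := fun c v => by
        have h1 : ip a b (M.toFun w) (M.derivFun (c • v)) =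
            c * ip a b (M.toFun w) (M.derivFun v) := by
          simp [Mesh.toFun, Mesh.derivFun, Mesh.ip_pw_pw, Finset.mul_sum, mul_left_comm]
        have h2 : ∀ j, M.jump (c • v) j = c * M.jump v j := fun j => by
          simp [Mesh.jump, Mesh.traceL, Mesh.traceR]; ring
        simp only [Mesh.dgForm, h1, h2, mul_left_comm _ c, ← Finset.mul_sum, RingHom.id_apply,
          smul_eq_mul]
        ring }
  exact M.ip_riesz F v

/-- The orthogonality that defines `Π₀`. -/
theorem Mesh.ip_proj (M : Mesh a b N) {f : ℝ → ℝ} (hf : Continuous f) (v : DGSpace N k) :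
    ip a b (M.toFun (M.proj k f)) (M.toFun v) = ip a b f (M.toFun v) := by
  let F : DGSpace N k →ₗ[ℝ] ℝ :=
    { toFun := fun v => ip a b f (M.toFun v)
      map_add' := fun u v => by
        simp only [Mesh.toFun, M.ip_cont_pw hf, ← Finset.sum_add_distrib]
        refine Finset.sum_congr rfl fun j _ => ?_
        simpa using integral_mul_add hf (u j : ℝ[X]).continuous (v j : ℝ[X]).continuous
          (M.left j) (M.right j)
      map_smul' := fun c v => by
        simp [Mesh.toFun, M.ip_cont_pw hf, Finset.mul_sum, mul_left_comm] }
  exact M.ip_riesz F v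

end

end PeriodicDG

/-!
Let `z ∈ Z_h` and let `U` be a primitive of `D_{h,θ} z`. Integrating the definition of `D_{h,θ}` by
parts shows that, for a suitable constant in `U`, the function `z` is a generalized Gauss–Radau
projection of `U`: on each cell the moments of order less than `k` agree, and the numerical fluxes
of `z` are the values of `U` at the nodes.

Such projections are stable uniformly in the mesh. On one cell, a polynomial of degree `k` is
controlled by its moments of order less than `k` and one end value, and orthogonality to the
Legendre polynomial of degree `k` relates its two end values up to these moments. The fluxes thus
give a cyclic system `θ t_j ± (1 - θ) t_{j+1}` for the left traces, which is boundedly invertible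
because `|θ| ≠ |1 - θ|`.

Comparing `z` with the Taylor polynomials of `f` therefore bounds `f - z` by `∂_x f - D_{h,θ} z`
plus a term of order `h^{k+1}`, provided that `f` and `z` have mean zero. This makes `D_{h,θ}`
bijective on `Z_h`, and by induction on `i` it reduces the error estimate to that of `Π₀`.
-/

namespace PeriodicDG

open Polynomial MeasureTheory

section Polynomials

theorem derivative_mem_degreeLT {R : Type*} [Semiring R] {n : ℕ} {p : R[X]}
    (hp : p ∈ degreeLT R (n + 1)) : derivative p ∈ degreeLT R n := by
  rw [mem_degreeLT, degree_lt_iff_coeff_zero] at hp ⊢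
  intro m hm
  rw [coeff_derivative, hp (m + 1) (by omega), zero_mul]

theorem exists_derivative_eq {K : Type*} [Field K] [CharZero K] {n : ℕ} {p : K[X]}
    (hp : p ∈ degreeLT K n) : ∃ q ∈ degreeLT K (n + 1), derivative q = p := by
  refine ⟨∑ i ∈ Finset.range n, monomial (i + 1) (p.coeff i / (i + 1)),
    Submodule.sum_mem _ fun i hi => ?_, ?_⟩
  · rw [mem_degreeLT]
    refine (degree_monomial_le _ _).trans_lt ?_
    exact_mod_cast Nat.succ_lt_succ (Finset.mem_range.1 hi)
  · have hcoeff (i : ℕ) : p.coeff i / (i + 1) * ((i + 1 : ℕ) : K) = p.coeff i := by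
      push_cast
      exact div_mul_cancel₀ _ (Nat.cast_add_one_ne_zero i)
    simp only [derivative_sum, derivative_monomial, hcoeff, Nat.add_sub_cancel]
    ext m
    simp only [finsetSum_coeff, coeff_monomial, Finset.sum_ite_eq', Finset.mem_range]
    split_ifs with hm
    · rfl
    · exact ((degree_lt_iff_coeff_zero _ _).1 (mem_degreeLT.1 hp) m (not_lt.1 hm)).symm

theorem comp_linear_mem_degreeLT {R : Type*} [Semiring R] {n : ℕ} {p : R[X]}
    (hp : p ∈ degreeLT R n) (c d : R) : p.comp (C c * X + C d) ∈ degreeLT R n := by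
  rcases eq_or_ne p 0 with rfl | hp0
  · simp only [zero_comp, Submodule.zero_mem]
  rw [mem_degreeLT, ← natDegree_lt_iff_degree_lt hp0] at hp
  rw [mem_degreeLT]
  refine (degree_le_natDegree.trans (Nat.cast_le.2 ?_)).trans_lt (Nat.cast_lt.2 hp)
  simpa using natDegree_comp_le.trans (Nat.mul_le_mul_left p.natDegree natDegree_linear_le)

theorem integral_eval_mul_eval_derivative (p q : ℝ[X]) (l r : ℝ) :
    ∫ x in l..r, p.eval x * (derivative q).eval x =
      p.eval r * q.eval r - p.eval l * q.eval l -
        ∫ x in l..r, (derivative p).eval x * q.eval x :=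
  intervalIntegral.integral_mul_deriv_eq_deriv_mul (fun x _ => p.hasDerivAt x)
    (fun x _ => q.hasDerivAt x) ((derivative p).continuous.intervalIntegrable _ _)
    ((derivative q).continuous.intervalIntegrable _ _)

theorem integral_eval_mul_iterate_derivative_eq_zero {l r : ℝ} {m : ℕ} {p F : ℝ[X]}
    (hp : p ∈ degreeLT ℝ m) (hF : ((X - C l) * (C r - X)) ^ m ∣ F) :
    ∫ x in l..r, p.eval x * (derivative^[m] F).eval x = 0 := by
  induction m generalizing p with
  | zero =>
    obtain rfl : p = 0 := by simpa [mem_degreeLT, Nat.WithBot.lt_zero_iff] using hp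
    simp only [eval_zero, zero_mul, intervalIntegral.integral_zero]
  | succ m ih =>
    obtain ⟨g, hg⟩ : (X - C l) * (C r - X) ∣ derivative^[m] F := by
      simpa using pow_sub_dvd_iterate_derivative_of_pow_dvd (m := m) hF
    rw [Function.iterate_succ_apply', integral_eval_mul_eval_derivative,
      ih (derivative_mem_degreeLT hp) ((pow_dvd_pow _ m.le_succ).trans hF), hg]
    simp only [eval_mul, eval_sub, eval_X, eval_C, sub_self, zero_mul, mul_zero]

/-- The Legendre polynomial of degree `k` on `[0, 1]`, normalised by the value `1` at `0`. -/
noncomputable def legendre (k : ℕ) : ℝ[X] := (shiftedLegendre k).map (Int.castRingHom ℝ)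

theorem legendre_mem_degreeLT (k : ℕ) : legendre k ∈ degreeLT ℝ (k + 1) := by
  rw [mem_degreeLT]
  refine degree_map_le.trans_lt ?_
  rw [degree_shiftedLegendre]
  exact_mod_cast k.lt_succ_self

theorem legendre_eval_zero (k : ℕ) : (legendre k).eval 0 = 1 := by
  rw [← coeff_zero_eq_eval_zero, legendre, coeff_map, coeff_shiftedLegendre]
  simp

theorem legendre_eval_one (k : ℕ) : (legendre k).eval 1 = (-1) ^ k := by
  have hsymm := shiftedLegendre_eval_symm k (1 : ℝ)
  rw [sub_self, aeval_def, aeval_def, ← eval_map, ← eval_map] at hsymm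
  exact hsymm.trans ((congrArg _ (legendre_eval_zero k)).trans (mul_one _))

theorem integral_eval_mul_legendre_eq_zero {k : ℕ} {p : ℝ[X]} (hp : p ∈ degreeLT ℝ k) :
    ∫ x in (0 : ℝ)..1, p.eval x * (legendre k).eval x = 0 := by
  have hrodrigues : C (k.factorial : ℝ) * legendre k =
      derivative^[k] (((X - C 0) * (C 1 - X)) ^ k) := by
    have h := congrArg (Polynomial.map (Int.castRingHom ℝ)) (factorial_mul_shiftedLegendre_eq k)
    rw [Polynomial.map_mul, ← iterate_derivative_map] at h
    simpa [legendre, mul_pow] using h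
  have horth := integral_eval_mul_iterate_derivative_eq_zero (l := 0) (r := 1) hp dvd_rfl
  rw [← hrodrigues] at horth
  simpa [mul_left_comm, k.factorial_ne_zero] using horth

end Polynomials

section MomentBound

/-- The weak form of `|f| ≤ G` on `[l, r]` that only sees the moments of `f` against polynomials of
degree less than `k`. -/
def MomentBound (k : ℕ) (l r G : ℝ) (f : ℝ → ℝ) : Prop :=
  ∀ q ∈ degreeLT ℝ k, |∫ x in l..r, f x * q.eval x| ≤ G * ∫ x in l..r, |q.eval x|

variable {k : ℕ} {l r G : ℝ} {f : ℝ → ℝ} {p : ℝ[X]}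

theorem MomentBound.mono {G' : ℝ} (hf : MomentBound k l r G f) (hlr : l ≤ r) (hG : G ≤ G') :
    MomentBound k l r G' f := fun q hq =>
  (hf q hq).trans <| mul_le_mul_of_nonneg_right hG <|
    intervalIntegral.integral_nonneg hlr fun _ _ => abs_nonneg _

theorem MomentBound.of_abs_le (hf : Continuous f) (hlr : l ≤ r)
    (hG : ∀ x ∈ Set.Icc l r, |f x| ≤ G) : MomentBound k l r G f := fun q _ => by
  rw [← intervalIntegral.integral_const_mul]
  refine (intervalIntegral.abs_integral_le_integral_abs hlr).trans
    (intervalIntegral.integral_mono_on hlr ?_ ?_ fun x hx => ?_)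
  · exact (hf.mul q.continuous).abs.intervalIntegrable _ _
  · exact (continuous_const.mul q.continuous.abs).intervalIntegrable _ _
  · rw [abs_mul]
    exact mul_le_mul_of_nonneg_right (hG x hx) (abs_nonneg _)

theorem MomentBound.comp_linear (hf : MomentBound k l r G f) (hlr : l < r) :
    MomentBound k 0 1 G fun t => f ((r - l) * t + l) := fun q hq => by
  have hd : r - l ≠ 0 := (sub_pos.2 hlr).ne'
  set q' := q.comp (C (r - l)⁻¹ * X + C (-(r - l)⁻¹ * l)) with hq'
  have hq_eval (t : ℝ) : q.eval t = q'.eval ((r - l) * t + l) := by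
    simp only [hq', eval_comp, eval_add, eval_mul, eval_C, eval_X]
    congr 1
    field_simp
    ring
  have hscale (g : ℝ → ℝ) :
      ∫ t in (0 : ℝ)..1, g ((r - l) * t + l) = (r - l)⁻¹ * ∫ x in l..r, g x := by
    simpa using intervalIntegral.integral_comp_mul_add g (a := 0) (b := 1) hd l
  simp only [hq_eval, hscale fun x => f x * q'.eval x, hscale fun x => |q'.eval x|]
  rw [abs_mul, abs_of_pos (inv_pos.2 (sub_pos.2 hlr)), mul_left_comm]
  exact mul_le_mul_of_nonneg_left (hf q' (comp_linear_mem_degreeLT hq _ _))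
    (inv_pos.2 (sub_pos.2 hlr)).le

theorem eq_zero_of_eval_eq_zero_of_integral_mul_eq_zero (hlr : l < r) (hp : p ∈ degreeLT ℝ (k + 1))
    (hpr : p.eval r = 0)
    (hmom : ∀ q ∈ degreeLT ℝ k, ∫ x in l..r, p.eval x * q.eval x = 0) : p = 0 := by
  obtain ⟨m, rfl⟩ := dvd_iff_isRoot.2 hpr
  by_contra hne
  have hm : m ≠ 0 := right_ne_zero_of_mul hne
  have hmk : m ∈ degreeLT ℝ k := by
    rw [mem_degreeLT, ← natDegree_lt_iff_degree_lt hne,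
      natDegree_mul (X_sub_C_ne_zero r) hm, natDegree_X_sub_C] at hp
    exact mem_degreeLT.2 ((natDegree_lt_iff_degree_lt hm).1 (by omega))
  obtain ⟨c, hc, hmc⟩ : ∃ c ∈ Set.Ioo l r, m.eval c ≠ 0 := by
    by_contra! hzero
    exact hm (eq_zero_of_infinite_isRoot _ ((Set.Ioo_infinite hlr).mono hzero))
  have hpos : 0 < ∫ x in l..r, (r - x) * (m.eval x * m.eval x) :=
    intervalIntegral.integral_pos hlr (by fun_prop)
      (fun x hx => mul_nonneg (sub_nonneg.2 hx.2) (mul_self_nonneg _))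
      ⟨c, Set.Ioo_subset_Icc_self hc, mul_pos (sub_pos.2 hc.2) (mul_self_pos.2 hmc)⟩
  have hneg : ∫ x in l..r, (r - x) * (m.eval x * m.eval x) =
      -∫ x in l..r, ((X - C r) * m).eval x * m.eval x := by
    rw [← intervalIntegral.integral_neg]
    congr 1 with x
    simp only [eval_mul, eval_sub, eval_X, eval_C]
    ring
  rw [hneg, hmom m hmk, neg_zero] at hpos
  exact hpos.false

theorem integral_mul_eq_zero_of_moments (hf : Continuous f)
    (hmom : ∀ i < k, ∫ x in l..r, f x * x ^ i = 0) {q : ℝ[X]} (hq : q ∈ degreeLT ℝ k) :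
    ∫ x in l..r, f x * q.eval x = 0 := by
  rw [degreeLT_eq_span_X_pow] at hq
  induction hq using Submodule.span_induction with
  | mem q hq =>
    simp only [Finset.coe_image, Finset.coe_range, Set.mem_image, Set.mem_Iio] at hq
    obtain ⟨i, hi, rfl⟩ := hq
    simpa using hmom i hi
  | zero => simp
  | add q q' _ _ hq hq' =>
    simp only [eval_add]
    rw [integral_mul_add hf q.continuous q'.continuous, hq, hq', add_zero]
  | smul c q _ hq => simp [mul_left_comm _ c, hq]

theorem exists_norm_le_mul_norm_of_injective {𝕜 V E F : Type*} [NontriviallyNormedField 𝕜]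
    [CompleteSpace 𝕜] [AddCommGroup V] [Module 𝕜 V] [NormedAddCommGroup E] [NormedSpace 𝕜 E]
    [FiniteDimensional 𝕜 E] [SeminormedAddCommGroup F] [NormedSpace 𝕜 F] {S : V →ₗ[𝕜] E}
    (hS : Function.Injective S) (T : V →ₗ[𝕜] F) : ∃ K > 0, ∀ v, ‖T v‖ ≤ K * ‖S v‖ := by
  obtain ⟨L, hL⟩ := S.exists_leftInverse_of_injective (LinearMap.ker_eq_bot.2 hS)
  let A : E →L[𝕜] F := (T ∘ₗ L).toContinuousLinearMap
  refine ⟨‖A‖ + 1, by positivity, fun v => ?_⟩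
  calc ‖T v‖ = ‖A (S v)‖ := by simp [A, ← LinearMap.comp_apply, hL]
    _ ≤ ‖A‖ * ‖S v‖ := A.le_opNorm _
    _ ≤ (‖A‖ + 1) * ‖S v‖ := by gcongr; linarith

theorem exists_abs_eval_le_of_abs_moment_le (k : ℕ) : ∃ K > 0, ∀ p ∈ degreeLT ℝ (k + 1), ∀ B : ℝ,
    (∀ i < k, |∫ x in (0 : ℝ)..1, p.eval x * x ^ i| ≤ B) → |p.eval 1| ≤ B →
      ∀ x ∈ Set.Icc (0 : ℝ) 1, |p.eval x| ≤ K * B := by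
  let moment (i : ℕ) : ℝ[X] →ₗ[ℝ] ℝ :=
    { toFun := fun p => ∫ x in (0 : ℝ)..1, p.eval x * x ^ i
      map_add' := fun p q => by
        simpa [mul_comm] using integral_mul_add (continuous_pow i) p.continuous q.continuous 0 1
      map_smul' := fun c p => by simp [mul_assoc] }
  let S : degreeLT ℝ (k + 1) →ₗ[ℝ] (Fin k → ℝ) × ℝ :=
    ((LinearMap.pi fun i : Fin k => moment i).prod (leval 1)).domRestrict _
  have hS : Function.Injective S := (injective_iff_map_eq_zero S).2 fun p hp =>
    Subtype.ext <| eq_zero_of_eval_eq_zero_of_integral_mul_eq_zero one_pos p.2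
      (congrArg Prod.snd hp) fun _ => integral_mul_eq_zero_of_moments (p : ℝ[X]).continuous
        fun i hi => congrFun (congrArg Prod.fst hp) ⟨i, hi⟩
  obtain ⟨K, hK, hKS⟩ := exists_norm_le_mul_norm_of_injective hS
    ((toContinuousMapOnAlgHom (Set.Icc (0 : ℝ) 1)).toLinearMap.domRestrict (degreeLT ℝ (k + 1)))
  refine ⟨K, hK, fun p hp B hmom h1 x hx => ?_⟩
  have hSB : ‖S ⟨p, hp⟩‖ ≤ B := max_le
    ((pi_norm_le_iff_of_nonneg ((abs_nonneg _).trans h1)).2 fun i => hmom i i.2) h1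
  exact ((ContinuousMap.norm_coe_le_norm _ (⟨x, hx⟩ : Set.Icc (0 : ℝ) 1)).trans
    (hKS ⟨p, hp⟩)).trans (by gcongr)

theorem exists_abs_eval_le_of_momentBound (k : ℕ) : ∃ K > 0, ∀ {l r : ℝ}, l < r →
    ∀ p ∈ degreeLT ℝ (k + 1), ∀ G ≥ 0, MomentBound k l r G p.eval →
      ∀ x ∈ Set.Icc l r, |p.eval x| ≤ K * (G + |p.eval r|) := by
  obtain ⟨K, hK, hunit⟩ := exists_abs_eval_le_of_abs_moment_le k
  refine ⟨K, hK, fun {l r} hlr p hp G hG hmom x hx => ?_⟩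
  have hd : 0 < r - l := sub_pos.2 hlr
  set p' := p.comp (C (r - l) * X + C l) with hp'
  have hp_eval (t : ℝ) : p'.eval t = p.eval ((r - l) * t + l) := by simp [hp']
  have hmom' (i : ℕ) (hi : i < k) :
      |∫ t in (0 : ℝ)..1, p'.eval t * t ^ i| ≤ G + |p'.eval 1| := by
    have hXi : (X ^ i : ℝ[X]) ∈ degreeLT ℝ k := by
      rw [mem_degreeLT, degree_X_pow]
      exact_mod_cast hi
    have hpow : |∫ t in (0 : ℝ)..1, p'.eval t * t ^ i| ≤ G * ∫ t in (0 : ℝ)..1, |t ^ i| := by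
      simpa [hp_eval] using hmom.comp_linear hlr _ hXi
    have hle : ∫ t in (0 : ℝ)..1, |t ^ i| ≤ 1 := by
      refine (le_abs_self _).trans ?_
      simpa using intervalIntegral.norm_integral_le_of_norm_le_const (C := 1) (a := 0) (b := 1)
        (f := fun t : ℝ => |t ^ i|) fun t ht => by
          rw [Set.uIoc_of_le zero_le_one] at ht
          simpa [abs_of_pos ht.1] using pow_le_one₀ ht.1.le ht.2
    nlinarith [abs_nonneg (p'.eval 1)]
  have hbound := hunit p' (comp_linear_mem_degreeLT hp _ _) _ hmom'
    (le_add_of_nonneg_left hG) ((x - l) / (r - l))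
    ⟨div_nonneg (sub_nonneg.2 hx.1) hd.le, (div_le_one hd).2 (by linarith [hx.2])⟩
  simpa only [hp_eval, mul_div_cancel₀ _ hd.ne', mul_one, sub_add_cancel] using hbound

/-- Integrate `p` times the derivative of the Legendre polynomial of degree `k` by parts: this is
controlled by the moments of `p`, while `p'` is orthogonal to the Legendre polynomial. -/
theorem exists_abs_eval_right_sub_eval_left_le (k : ℕ) : ∃ K ≥ 0, ∀ {l r : ℝ}, l < r →
    ∀ p ∈ degreeLT ℝ (k + 1), ∀ G, MomentBound k l r G p.eval →
      |(-1) ^ k * p.eval r - p.eval l| ≤ K * G := by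
  refine ⟨∫ t in (0 : ℝ)..1, |(derivative (legendre k)).eval t|,
    intervalIntegral.integral_nonneg zero_le_one fun _ _ => abs_nonneg _,
    fun {l r} hlr p hp G hmom => ?_⟩
  set p' := p.comp (C (r - l) * X + C l) with hp'
  have hp_eval (t : ℝ) : p'.eval t = p.eval ((r - l) * t + l) := by simp [hp']
  have hparts := integral_eval_mul_eval_derivative p' (legendre k) 0 1
  rw [integral_eval_mul_legendre_eq_zero
    (derivative_mem_degreeLT (comp_linear_mem_degreeLT hp _ _)), legendre_eval_one,
    legendre_eval_zero] at hparts
  have hbound := hmom.comp_linear hlr _ (derivative_mem_degreeLT (legendre_mem_degreeLT k))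
  simp only [← hp_eval, hparts] at hbound
  simpa [hp_eval, mul_comm] using hbound

end MomentBound

section Interval

variable {a b : ℝ} {f : ℝ → ℝ}

theorem memLp_of_continuous (hf : Continuous f) (p : ENNReal) (a b : ℝ) :
    MemLp f p (volume.restrict (Set.Ioc a b)) := by
  obtain ⟨C, hC⟩ := isCompact_Icc.exists_bound_of_continuousOn (s := Set.Icc a b) hf.continuousOn
  exact MemLp.of_bound hf.aestronglyMeasurable C <|
    (ae_restrict_mem measurableSet_Ioc).mono fun x hx => hC x (Set.Ioc_subset_Icc_self hx)

theorem ip_self_nonneg (hab : a ≤ b) (f : ℝ → ℝ) : 0 ≤ ip a b f f :=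
  intervalIntegral.integral_nonneg hab fun _ _ => mul_self_nonneg _

theorem l2norm_le_of_abs_le (hab : a ≤ b) {G : ℝ} (hf : ∀ x ∈ Set.Ioc a b, |f x| ≤ G) :
    l2norm a b f ≤ √(b - a) * G := by
  rcases hab.eq_or_lt with rfl | hlt
  · simp [l2norm, ip]
  have hG : 0 ≤ G := (abs_nonneg _).trans (hf b (Set.right_mem_Ioc.2 hlt))
  have hip : ip a b f f ≤ (b - a) * G ^ 2 := by
    have hnorm := intervalIntegral.norm_integral_le_of_norm_le_const (C := G ^ 2)
      (f := fun x => f x * f x) (a := a) (b := b) fun x hx => by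
        rw [Set.uIoc_of_le hab] at hx
        rw [norm_mul, ← sq]
        exact pow_le_pow_left₀ (abs_nonneg _) (hf x hx) 2
    rw [abs_of_nonneg (sub_nonneg.2 hab), mul_comm] at hnorm
    exact (le_abs_self _).trans hnorm
  refine (Real.sqrt_le_sqrt hip).trans_eq ?_
  rw [Real.sqrt_mul (sub_nonneg.2 hab), Real.sqrt_sq hG]

theorem integral_abs_le_l2norm (hab : a ≤ b) (hf : MemLp f 2 (volume.restrict (Set.Ioc a b))) :
    ∫ x in a..b, |f x| ≤ √(b - a) * l2norm a b f := by
  have hholder := integral_mul_le_Lp_mul_Lq_of_nonneg (μ := volume.restrict (Set.Ioc a b))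
    Real.HolderConjugate.two_two (f := fun _ => (1 : ℝ)) (g := fun x => |f x|)
    (ae_of_all _ fun _ => zero_le_one) (ae_of_all _ fun x => abs_nonneg (f x))
    (memLp_const 1) (by rw [ENNReal.ofReal_ofNat]; exact hf.abs)
  simpa [intervalIntegral.integral_of_le hab, l2norm, ip, Real.sqrt_eq_rpow, ← sq, hab]
    using hholder

theorem ip_sub_self_le_of_orthogonal {p t : ℝ → ℝ} (hab : a ≤ b) (hf : Continuous f)
    (hp : Continuous p) (ht : Continuous t)
    (horth : ∫ x in a..b, (f x - p x) * (p x - t x) = 0) :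
    ip a b (fun x => f x - p x) (fun x => f x - p x) ≤
      ip a b (fun x => f x - t x) (fun x => f x - t x) := by
  have hint {g : ℝ → ℝ} (hg : Continuous g) : IntervalIntegrable g volume a b :=
    hg.intervalIntegrable _ _
  have hexpand (x : ℝ) : (f x - t x) * (f x - t x) = (f x - p x) * (f x - p x) +
      (2 * ((f x - p x) * (p x - t x)) + (p x - t x) * (p x - t x)) := by ring
  have hpythagoras : ip a b (fun x => f x - t x) (fun x => f x - t x) =
      ip a b (fun x => f x - p x) (fun x => f x - p x) +
        ip a b (fun x => p x - t x) (fun x => p x - t x) := by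
    simp only [ip, hexpand]
    rw [intervalIntegral.integral_add (hint (by fun_prop)) (hint (by fun_prop)),
      intervalIntegral.integral_add (hint (by fun_prop)) (hint (by fun_prop)),
      intervalIntegral.integral_const_mul, horth, mul_zero, zero_add]
  rw [hpythagoras]
  exact le_add_of_nonneg_right (ip_self_nonneg hab _)

theorem abs_integral_le_integral_abs_of_mem (hf : IntervalIntegrable f volume a b)
    {x y : ℝ} (hx : x ∈ Set.Icc a b) (hy : y ∈ Set.Icc a b) :
    |∫ t in x..y, f t| ≤ ∫ t in a..b, |f t| := by
  have hab := hx.1.trans hx.2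
  have hsub : Set.uIoc x y ⊆ Set.uIoc a b := by
    rw [Set.uIoc_of_le hab]
    exact Set.Ioc_subset_Ioc (le_min hx.1 hy.1) (max_le hx.2 hy.2)
  have hnorm : |∫ t in x..y, f t| ≤ |∫ t in x..y, (|f t|)| :=
    intervalIntegral.norm_integral_le_abs_integral_norm (f := f)
  calc |∫ t in x..y, f t| ≤ |∫ t in x..y, (|f t|)| := hnorm
    _ ≤ |∫ t in a..b, (|f t|)| := intervalIntegral.abs_integral_mono_interval hsub
        (ae_of_all _ fun _ => abs_nonneg _) hf.abs
    _ = _ := abs_of_nonneg (intervalIntegral.integral_nonneg hab fun _ _ => abs_nonneg _)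

theorem abs_le_two_mul_of_integral_eq_zero (hf : IntervalIntegrable f volume a b)
    (hmean : ∫ x in a..b, f x = 0) {c G : ℝ} (hc : ∀ x ∈ Set.Ioc a b, |f x - c| ≤ G) {x : ℝ}
    (hx : x ∈ Set.Ioc a b) : |f x| ≤ 2 * G := by
  have hab : 0 < b - a := sub_pos.2 (hx.1.trans_le hx.2)
  have hcG : |c| ≤ G := by
    have hint := intervalIntegral.norm_integral_le_of_norm_le_const (f := fun x => f x - c)
      (C := G) fun x hx => hc x (by rwa [Set.uIoc_of_le (sub_pos.1 hab).le] at hx)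
    rw [intervalIntegral.integral_sub hf (by simp), hmean, intervalIntegral.integral_const,
      smul_eq_mul, zero_sub, norm_neg, norm_mul, mul_comm, Real.norm_of_nonneg hab.le,
      abs_of_pos hab] at hint
    exact le_of_mul_le_mul_right hint hab
  calc |f x| = |(f x - c) + c| := by rw [sub_add_cancel]
    _ ≤ G + G := (abs_add_le _ _).trans (add_le_add (hc x hx) hcG)
    _ = 2 * G := (two_mul G).symm

theorem sub_taylor_eq_integral {n : ℕ} (hf : ContDiff ℝ (n + 1 : ℕ) f) (x₀ x : ℝ) :
    f x - ∑ i ∈ Finset.range (n + 1), iteratedDeriv i f x₀ / i.factorial * (x - x₀) ^ i =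
      ∫ t in x₀..x, (x - t) ^ n / n.factorial * iteratedDeriv (n + 1) f t := by
  rcases eq_or_ne x₀ x with rfl | hne
  · simp [Finset.sum_range_succ']
  have hwithin {i : ℕ} (hi : i ≤ n + 1) {t : ℝ} (ht : t ∈ Set.uIcc x₀ x) :
      iteratedDerivWithin i f (Set.uIcc x₀ x) t = iteratedDeriv i f t :=
    iteratedDerivWithin_eq_iteratedDeriv (uniqueDiffOn_uIcc hne)
      (hf.of_le (Nat.cast_le.2 hi)).contDiffAt ht
  have htaylor := taylor_integral_remainder (x₀ := x₀) (x := x) hf.contDiffOn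
  rw [taylor_within_apply] at htaylor
  calc _ = _ := by
        congr 1
        refine Finset.sum_congr rfl fun i hi => ?_
        rw [hwithin (Finset.mem_range.1 hi).le Set.left_mem_uIcc, smul_eq_mul]
        ring
    _ = _ := htaylor
    _ = _ := intervalIntegral.integral_congr fun t ht =>
        congrArg ((x - t) ^ n / n.factorial * ·) (hwithin le_rfl ht)

theorem exists_mem_degreeLT_abs_sub_eval_le {k : ℕ} (hf : ContDiff ℝ (k + 1 : ℕ) f) (a b : ℝ) :
    ∃ T ∈ degreeLT ℝ (k + 1), ∀ x ∈ Set.Icc a b,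
      |f x - T.eval x| ≤ (b - a) ^ k * ∫ t in a..b, |iteratedDeriv (k + 1) f t| := by
  refine ⟨∑ i ∈ Finset.range (k + 1), (iteratedDeriv i f a / i.factorial) • (X - C a) ^ i,
    Submodule.sum_mem _ fun i hi => Submodule.smul_mem _ _ ?_, fun x hx => ?_⟩
  · rw [mem_degreeLT, degree_pow, degree_X_sub_C, nsmul_one]
    exact Nat.cast_lt.2 (Finset.mem_range.1 hi)
  have hcont := hf.continuous_iteratedDeriv (k + 1) le_rfl
  have hab : 0 ≤ b - a := sub_nonneg.2 (hx.1.trans hx.2)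
  have hkernel (t : ℝ) (ht : t ∈ Set.Icc a x) : |(x - t) ^ k / k.factorial| ≤ (b - a) ^ k := by
    have hxt : 0 ≤ x - t := sub_nonneg.2 ht.2
    rw [abs_of_nonneg (by positivity)]
    calc (x - t) ^ k / k.factorial ≤ (x - t) ^ k :=
          div_le_self (by positivity) (Nat.one_le_cast.2 k.factorial_pos)
      _ ≤ (b - a) ^ k := by gcongr; exacts [hx.2, ht.1]
  have hremainder := sub_taylor_eq_integral hf a x
  simp only [eval_finsetSum, eval_smul, eval_pow, eval_sub, eval_X, eval_C, smul_eq_mul]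
  calc _ = |∫ t in a..x, (x - t) ^ k / k.factorial * iteratedDeriv (k + 1) f t| :=
        congrArg _ hremainder
    _ ≤ ∫ t in a..x, |(x - t) ^ k / k.factorial * iteratedDeriv (k + 1) f t| :=
        intervalIntegral.abs_integral_le_integral_abs hx.1
    _ ≤ ∫ t in a..x, (b - a) ^ k * |iteratedDeriv (k + 1) f t| := by
        refine intervalIntegral.integral_mono_on hx.1 ?_ ?_ fun t ht => ?_
        · exact Continuous.intervalIntegrable (by fun_prop) _ _
        · exact Continuous.intervalIntegrable (by fun_prop) _ _
        · rw [abs_mul]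
          gcongr
          exact hkernel t ht
    _ ≤ (b - a) ^ k * ∫ t in a..b, |iteratedDeriv (k + 1) f t| := by
        rw [intervalIntegral.integral_const_mul]
        gcongr
        exact intervalIntegral.integral_mono_interval le_rfl hx.1 hx.2
          (ae_of_all _ fun _ => abs_nonneg _) (hcont.abs.intervalIntegrable _ _)

end Interval

section Periodic

variable {a b : ℝ} {f : ℝ → ℝ}

theorem periodic_deriv {c : ℝ} (hf : Function.Periodic f c) : Function.Periodic (deriv f) c :=
  fun x => by rw [← deriv_comp_add_const, funext hf]

theorem periodic_iteratedDeriv {c : ℝ} (hf : Function.Periodic f c) (n : ℕ) :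
    Function.Periodic (iteratedDeriv n f) c := by
  induction n with
  | zero => rwa [iteratedDeriv_zero]
  | succ n ih => rw [iteratedDeriv_succ]; exact periodic_deriv ih

theorem apply_eq_of_periodic_sub (hf : Function.Periodic f (b - a)) : f a = f b := by
  simpa using (hf a).symm

theorem abs_deriv_le_integral_abs (hab : a < b) (hf : ContDiff ℝ 2 f) (hfab : f a = f b) {x : ℝ}
    (hx : x ∈ Set.Icc a b) : |deriv f x| ≤ ∫ t in a..b, |deriv (deriv f) t| := by
  obtain ⟨c, hc, hfc⟩ := exists_deriv_eq_zero hab hf.continuous.continuousOn hfab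
  have hf' : ContDiff ℝ 1 (deriv f) := ContDiff.deriv' (by rwa [one_add_one_eq_two])
  calc |deriv f x| = |∫ t in c..x, deriv (deriv f) t| := by
        rw [intervalIntegral.integral_deriv_of_contDiffOn_uIcc hf'.contDiffOn, hfc, sub_zero]
    _ ≤ ∫ t in a..b, |deriv (deriv f) t| := abs_integral_le_integral_abs_of_mem
        (hf'.continuous_deriv_one.intervalIntegrable _ _) (Set.Ioo_subset_Icc_self hc) hx

theorem abs_iteratedDeriv_le_integral_abs_of_periodic {n : ℕ} (hab : a < b)
    (hf : ContDiff ℝ (n + 2 : ℕ) f) (hper : Function.Periodic f (b - a)) {x : ℝ}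
    (hx : x ∈ Set.Icc a b) :
    |iteratedDeriv (n + 1) f x| ≤ ∫ t in a..b, |iteratedDeriv (n + 2) f t| := by
  have hfn : ContDiff ℝ 2 (iteratedDeriv n f) := by
    rw [iteratedDeriv_eq_iterate]
    exact ContDiff.iterate_deriv' 2 n (by rw [add_comm]; exact hf)
  simpa only [iteratedDeriv_succ] using
    abs_deriv_le_integral_abs hab hfn (apply_eq_of_periodic_sub (periodic_iteratedDeriv hper n)) hx

theorem integral_deriv_eq_zero_of_periodic (hf : ContDiff ℝ 1 f)
    (hper : Function.Periodic f (b - a)) : ∫ x in a..b, deriv f x = 0 := by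
  rw [intervalIntegral.integral_deriv_of_contDiffOn_uIcc hf.contDiffOn,
    apply_eq_of_periodic_sub hper, sub_self]

theorem integral_iteratedDeriv_eq_zero {i : ℕ} (hf : ContDiff ℝ i f)
    (hper : Function.Periodic f (b - a)) (hmean : ∫ x in a..b, f x = 0) :
    ∫ x in a..b, iteratedDeriv i f x = 0 := by
  cases i with
  | zero => simpa only [iteratedDeriv_zero] using hmean
  | succ i =>
    rw [iteratedDeriv_succ]
    refine integral_deriv_eq_zero_of_periodic ?_ (periodic_iteratedDeriv hper i)
    rw [iteratedDeriv_eq_iterate]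
    exact ContDiff.iterate_deriv' 1 i (by rw [add_comm]; exact hf)

end Periodic

section Mesh

variable {a b : ℝ} {N k : ℕ}

theorem Mesh.node_mem (M : Mesh a b N) (i : Fin (N + 1)) : M.node i ∈ Set.Icc a b :=
  ⟨M.node_zero.ge.trans (M.node_strictMono.monotone (Fin.zero_le i)),
    (M.node_strictMono.monotone (Fin.le_last i)).trans M.node_last.le⟩

theorem Mesh.le (M : Mesh a b N) : a ≤ b :=
  (M.node_mem 0).1.trans (M.node_mem 0).2

theorem Mesh.cell_subset (M : Mesh a b N) (j : Fin N) :
    Set.Icc (M.left j) (M.right j) ⊆ Set.Icc a b :=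
  Set.Icc_subset_Icc (M.node_mem _).1 (M.node_mem _).2

theorem Mesh.exists_mem_cell (M : Mesh a b N) {x : ℝ} (hx : x ∈ Set.Ioc a b) :
    ∃ j, x ∈ Set.Ioc (M.left j) (M.right j) := by
  by_contra! hcell
  have hlt (i) : M.node i < x := by
    induction i using Fin.induction with
    | zero => exact M.node_zero.trans_lt hx.1
    | succ j ih => exact not_le.1 fun h => hcell j ⟨ih, h⟩
  exact (M.node_last.symm.trans_lt (hlt (Fin.last N))).not_ge hx.2

theorem Mesh.cellLength_le_h (M : Mesh a b N) (j : Fin N) : M.right j - M.left j ≤ M.h :=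
  le_ciSup (f := M.cellLength) (Set.finite_range _).bddAbove j

theorem Mesh.h_nonneg (M : Mesh a b N) : 0 ≤ M.h :=
  Real.iSup_nonneg fun j => sub_nonneg.2 (M.left_lt_right j).le

theorem Mesh.toFun_eq (M : Mesh a b N) (z : DGSpace N k) {j : Fin N} {x : ℝ}
    (hx : x ∈ Set.Ioc (M.left j) (M.right j)) : M.toFun z x = (z j : ℝ[X]).eval x :=
  M.pw_eq _ j hx

theorem Mesh.memLp_pw (M : Mesh a b N) (P : Fin N → ℝ[X]) (p : ENNReal) :
    MemLp (M.pw P) p volume :=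
  memLp_finsetSum _ fun j _ => (memLp_indicator_iff_restrict measurableSet_Ioc).2 <|
    memLp_of_continuous (P j).continuous p _ _

theorem Mesh.intervalIntegrable_toFun (M : Mesh a b N) (z : DGSpace N k) (c d : ℝ) :
    IntervalIntegrable (M.toFun z) volume c d :=
  (memLp_one_iff_integrable.1 (M.memLp_pw _ 1)).intervalIntegrable

theorem Mesh.integral_toFun_mul (M : Mesh a b N) (z : DGSpace N k) (j : Fin N) (f : ℝ → ℝ) :
    ∫ x in (M.left j)..(M.right j), M.toFun z x * f x =
      ∫ x in (M.left j)..(M.right j), (z j : ℝ[X]).eval x * f x := by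
  refine intervalIntegral.integral_congr_ae (ae_of_all _ fun x hx => ?_)
  rw [Set.uIoc_of_le (M.left_lt_right j).le] at hx
  rw [M.toFun_eq z hx]

theorem Mesh.ip_pw_single (M : Mesh a b N) (f : ℝ → ℝ) (j : Fin N) (p : ℝ[X]) :
    ip a b f (M.pw (Pi.single j p)) = ∫ x in (M.left j)..(M.right j), f x * p.eval x := by
  have hpw (x : ℝ) : f x * M.pw (Pi.single j p) x =
      (Set.Ioc (M.left j) (M.right j)).indicator (fun x => f x * p.eval x) x := by
    rw [Mesh.pw, Finset.sum_eq_single j (fun i _ hij => by simp [hij]) (by simp),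
      Pi.single_eq_same, ← Set.indicator_mul_right]
  have hsub : Set.Ioc (M.left j) (M.right j) ⊆ Set.Ioc a b :=
    Set.Ioc_subset_Ioc (M.node_mem _).1 (M.node_mem _).2
  simp only [ip, hpw, intervalIntegral.integral_of_le M.le,
    intervalIntegral.integral_of_le (M.left_lt_right j).le]
  rw [setIntegral_indicator measurableSet_Ioc, Set.inter_eq_right.2 hsub]

theorem Mesh.ip_toFun_single (M : Mesh a b N) (f : ℝ → ℝ) (j : Fin N) (q : degreeLT ℝ (k + 1)) :
    ip a b f (M.toFun (Pi.single j q)) =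
      ∫ x in (M.left j)..(M.right j), f x * (q : ℝ[X]).eval x := by
  rw [← M.ip_pw_single, Mesh.toFun]
  congr 2
  exact funext <| Pi.apply_single (fun _ (q : degreeLT ℝ (k + 1)) => (q : ℝ[X])) (fun _ => rfl) j q

theorem Mesh.ip_derivFun_single (M : Mesh a b N) (f : ℝ → ℝ) (j : Fin N)
    (q : degreeLT ℝ (k + 1)) :
    ip a b f (M.derivFun (Pi.single j q)) =
      ∫ x in (M.left j)..(M.right j), f x * (derivative (q : ℝ[X])).eval x := by
  rw [← M.ip_pw_single, Mesh.derivFun]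
  congr 2
  exact funext <| Pi.apply_single (fun _ (q : degreeLT ℝ (k + 1)) => derivative (q : ℝ[X]))
    (fun _ => derivative_zero) j q

theorem Mesh.integral_proj_mul (M : Mesh a b N) {f : ℝ → ℝ} (hf : Continuous f) (j : Fin N)
    (q : degreeLT ℝ (k + 1)) :
    ∫ x in (M.left j)..(M.right j), (M.proj k f j : ℝ[X]).eval x * (q : ℝ[X]).eval x =
      ∫ x in (M.left j)..(M.right j), f x * (q : ℝ[X]).eval x := by
  rw [← M.ip_toFun_single f, ← M.ip_proj hf, M.ip_toFun_single, M.integral_toFun_mul]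

end Mesh

section MeanZero

variable {a b : ℝ} {N k : ℕ}

theorem one_mem_degreeLT (R : Type*) [Semiring R] (n : ℕ) : (1 : R[X]) ∈ degreeLT R (n + 1) :=
  mem_degreeLT.2 (degree_one_le.trans_lt (by exact_mod_cast n.succ_pos))

/-- The constant function `1` as an element of `V_h`. Testing with it gives the mean value. -/
noncomputable def oneDG (N k : ℕ) : DGSpace N k := fun _ => ⟨1, one_mem_degreeLT ℝ k⟩

theorem Mesh.ip_toFun_oneDG (M : Mesh a b N) (k : ℕ) (f : ℝ → ℝ) :
    ip a b f (M.toFun (oneDG N k)) = ∫ x in a..b, f x := by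
  refine intervalIntegral.integral_congr_ae (ae_of_all _ fun x hx => ?_)
  rw [Set.uIoc_of_le M.le] at hx
  obtain ⟨j, hj⟩ := M.exists_mem_cell hx
  simp only [M.toFun_eq _ hj, oneDG, eval_one, mul_one]

theorem Mesh.mem_Zh {M : Mesh a b N} {z : DGSpace N k} :
    z ∈ M.Zh k ↔ ∫ x in a..b, M.toFun z x = 0 := by
  simp only [Mesh.Zh, ip, mul_one, Set.mem_ofPred_eq]

/-- `Z_h` as a submodule of `V_h`. -/
noncomputable def Mesh.submoduleZh (M : Mesh a b N) (k : ℕ) : Submodule ℝ (DGSpace N k) :=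
  ((M.ipForm k).flip (oneDG N k)).ker

theorem Mesh.coe_submoduleZh (M : Mesh a b N) (k : ℕ) : (M.submoduleZh k : Set _) = M.Zh k := by
  ext z
  rw [Mesh.mem_Zh, ← M.ip_toFun_oneDG k]
  rfl

theorem Mesh.proj_mem_Zh (M : Mesh a b N) {f : ℝ → ℝ} (hf : Continuous f)
    (hmean : ∫ x in a..b, f x = 0) : M.proj k f ∈ M.Zh k := by
  rw [Mesh.mem_Zh, ← M.ip_toFun_oneDG k, M.ip_proj hf, M.ip_toFun_oneDG, hmean]

theorem Mesh.D_mem_Zh (M : Mesh a b N) (θ : ℝ) (z : DGSpace N k) : M.D θ z ∈ M.Zh k := by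
  have hderiv : M.derivFun (oneDG N k) = 0 := by
    ext x
    simp [Mesh.derivFun, Mesh.pw, oneDG]
  have hjump (j) : M.jump (oneDG N k) j = 0 := by
    simp [Mesh.jump, Mesh.traceL, Mesh.traceR, oneDG]
  rw [Mesh.mem_Zh, ← M.ip_toFun_oneDG k, M.ip_D, hderiv]
  simp [hjump, ip]

theorem Mesh.ext_of_ip (M : Mesh a b N) {z y : DGSpace N k}
    (h : ∀ v : DGSpace N k, ip a b (M.toFun z) (M.toFun v) = ip a b (M.toFun y) (M.toFun v)) :
    z = y := by
  refine sub_eq_zero.1 (M.eq_zero_of_ip_self _ ?_)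
  change M.ipForm k (z - y) (z - y) = 0
  rw [LinearMap.map_sub₂]
  exact sub_eq_zero.2 (h (z - y))

theorem Mesh.flux_add (M : Mesh a b N) (θ : ℝ) (w y : DGSpace N k) (j : Fin N) :
    M.flux θ (w + y) j = M.flux θ w j + M.flux θ y j := by
  simp only [Mesh.flux, Mesh.traceL, Mesh.traceR, Pi.add_apply, Submodule.coe_add, eval_add]
  ring

theorem Mesh.flux_smul (M : Mesh a b N) (θ c : ℝ) (w : DGSpace N k) (j : Fin N) :
    M.flux θ (c • w) j = c * M.flux θ w j := by
  simp only [Mesh.flux, Mesh.traceL, Mesh.traceR, Pi.smul_apply, Submodule.coe_smul, eval_smul,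
    smul_eq_mul]
  ring

/-- `D_{h,θ}` as a linear map. -/
noncomputable def Mesh.linearD (M : Mesh a b N) (k : ℕ) (θ : ℝ) :
    DGSpace N k →ₗ[ℝ] DGSpace N k where
  toFun := M.D θ
  map_add' w y := M.ext_of_ip fun v => by
    have hD : ip a b (M.toFun (M.D θ w + M.D θ y)) (M.toFun v) =
        ip a b (M.toFun (M.D θ w)) (M.toFun v) + ip a b (M.toFun (M.D θ y)) (M.toFun v) :=
      LinearMap.map_add₂ (M.ipForm k) _ _ v
    have hvol : ip a b (M.toFun (w + y)) (M.derivFun v) =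
        ip a b (M.toFun w) (M.derivFun v) + ip a b (M.toFun y) (M.derivFun v) := by
      simp only [Mesh.toFun, Mesh.derivFun, Mesh.ip_pw_pw, ← Finset.sum_add_distrib]
      refine Finset.sum_congr rfl fun j _ => ?_
      simpa [mul_comm] using integral_mul_add (derivative (v j : ℝ[X])).continuous
        (w j : ℝ[X]).continuous (y j : ℝ[X]).continuous (M.left j) (M.right j)
    rw [hD, M.ip_D, M.ip_D, M.ip_D, hvol]
    simp only [M.flux_add, add_mul, Finset.sum_add_distrib]
    ring
  map_smul' c w := M.ext_of_ip fun v => by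
    have hD : ip a b (M.toFun (c • M.D θ w)) (M.toFun v) =
        c * ip a b (M.toFun (M.D θ w)) (M.toFun v) :=
      LinearMap.map_smul₂ (M.ipForm k) c _ v
    have hvol : ip a b (M.toFun (c • w)) (M.derivFun v) =
        c * ip a b (M.toFun w) (M.derivFun v) := by
      simp [Mesh.toFun, Mesh.derivFun, Mesh.ip_pw_pw, Finset.mul_sum, mul_assoc]
    rw [RingHom.id_apply, hD, M.ip_D, M.ip_D, hvol]
    simp only [M.flux_smul, mul_assoc, ← Finset.mul_sum]
    ring

end MeanZero

section Stability

variable {a b : ℝ} {N k : ℕ}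

theorem abs_abs_sub_abs_mul_le_of_perm {ι : Type*} [Finite ι] (π : Equiv.Perm ι) {α β B : ℝ}
    {t : ι → ℝ} (h : ∀ j, |α * t j + β * t (π j)| ≤ B) (j : ι) : |(|α| - |β|)| * |t j| ≤ B := by
  have : Nonempty ι := ⟨j⟩
  obtain ⟨m, hm⟩ := Finite.exists_max fun j => |t j|
  refine (mul_le_mul_of_nonneg_left (hm j) (abs_nonneg _)).trans ?_
  rcases le_total |β| |α| with hβα | hαβ
  · have hsub := abs_sub_abs_le_abs_add (α * t m) (β * t (π m))
    have hmax := mul_le_mul_of_nonneg_left (hm (π m)) (abs_nonneg β)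
    rw [abs_mul, abs_mul] at hsub
    rw [abs_of_nonneg (sub_nonneg.2 hβα)]
    linarith [h m]
  · have hsub := abs_sub_abs_le_abs_add (β * t m) (α * t (π.symm m))
    have hmax := mul_le_mul_of_nonneg_left (hm (π.symm m)) (abs_nonneg α)
    have hm' := h (π.symm m)
    rw [abs_mul, abs_mul] at hsub
    rw [Equiv.apply_symm_apply, add_comm] at hm'
    rw [abs_of_nonpos (sub_nonpos.2 hαβ)]
    linarith

theorem abs_abs_sub_abs_one_sub_pos {θ : ℝ} (hθ : θ ≠ 1 / 2) : 0 < |(|θ| - |1 - θ|)| := by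
  refine abs_pos.2 (sub_ne_zero.2 fun h => ?_)
  rcases abs_eq_abs.1 h with h | h
  · exact hθ (by linarith)
  · linarith

theorem exists_abs_eval_le_of_abs_flux_le (k : ℕ) {θ : ℝ} (hθ : θ ≠ 1 / 2) : ∃ K > 0,
    ∀ {a b : ℝ} {N : ℕ} (M : Mesh a b N) (v : DGSpace N k) (G : ℝ),
      (∀ j, MomentBound k (M.left j) (M.right j) G (v j : ℝ[X]).eval) →
      (∀ j, |M.flux θ v j| ≤ G) →
      ∀ j, ∀ x ∈ Set.Icc (M.left j) (M.right j), |(v j : ℝ[X]).eval x| ≤ K * G := by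
  obtain ⟨K₁, hK₁, hends⟩ := exists_abs_eval_right_sub_eval_left_le k
  obtain ⟨K₂, hK₂, hcell⟩ := exists_abs_eval_le_of_momentBound k
  have hδ := abs_abs_sub_abs_one_sub_pos hθ
  set δ := |(|θ| - |1 - θ|)|
  refine ⟨K₂ * (1 + (1 + |1 - θ| * K₁) / δ), by positivity,
    fun M v G hmom hflux j x hx => ?_⟩
  have htrace : δ * |M.traceL v j| ≤ (1 + |1 - θ| * K₁) * G := by
    have hcycle (j) : |θ * M.traceL v j + (1 - θ) * (-1) ^ k * M.traceL v (finRotate _ j)| ≤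
        (1 + |1 - θ| * K₁) * G := by
      have hj := hends (M.left_lt_right (finRotate _ j)) _ (v _).2 G (hmom (finRotate _ j))
      calc _ = |M.flux θ v j +
            (1 - θ) * ((-1) ^ k * M.traceL v (finRotate _ j) - M.traceR v j)| := by
            rw [Mesh.flux]; ring_nf
        _ ≤ |M.flux θ v j| +
            |1 - θ| * |(-1) ^ k * M.traceL v (finRotate _ j) - M.traceR v j| := by
            rw [← abs_mul]; exact abs_add_le _ _
        _ ≤ G + |1 - θ| * (K₁ * G) := by gcongr; exacts [hflux j, hj]
        _ = _ := by ring
    simpa [δ, abs_mul] using abs_abs_sub_abs_mul_le_of_perm (finRotate _) hcycle j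
  have hG : 0 ≤ G := (abs_nonneg _).trans (hflux j)
  calc |(v j : ℝ[X]).eval x| ≤ K₂ * (G + |M.traceL v j|) :=
        hcell (M.left_lt_right j) _ (v j).2 G hG (hmom j) x hx
    _ ≤ K₂ * (G + (1 + |1 - θ| * K₁) * G / δ) := by
        gcongr
        rwa [le_div_iff₀' hδ]
    _ = _ := by ring

theorem Mesh.apply_left_finRotate (M : Mesh a b N) {α : Type*} {W : ℝ → α} (hW : W a = W b)
    (j : Fin N) : W (M.left (finRotate N j)) = W (M.right j) := by
  obtain _ | n := N
  · exact j.elim0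
  rw [finRotate_apply]
  induction j using Fin.lastCases with
  | last =>
    rw [Fin.last_add_one]
    exact (congrArg W M.node_zero).trans (hW.trans (congrArg W M.node_last).symm)
  | cast j =>
    rw [Fin.coeSucc_eq_succ]
    rfl

/-- The generalized Gauss–Radau conditions with parameter `θ`: on each cell the moments of `z` of
order less than `k` are those of `W`, and the fluxes of `z` are the values of `W` at the right ends
of the cells. -/
structure Mesh.IsGaussRadau (M : Mesh a b N) (θ : ℝ) (W : ℝ → ℝ) (z : DGSpace N k) : Prop where
  integral_mul_eq : ∀ j, ∀ q ∈ degreeLT ℝ k,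
    ∫ x in (M.left j)..(M.right j), (z j : ℝ[X]).eval x * q.eval x =
      ∫ x in (M.left j)..(M.right j), W x * q.eval x
  flux_eq : ∀ j, M.flux θ z j = W (M.right j)

theorem Mesh.IsGaussRadau.momentBound_sub {M : Mesh a b N} {θ : ℝ} {W : ℝ → ℝ} {z : DGSpace N k}
    (hz : M.IsGaussRadau θ W z) (hW : Continuous W) {T : DGSpace N k} {G : ℝ} {j : Fin N}
    (hT : ∀ x ∈ Set.Icc (M.left j) (M.right j), |W x - (T j : ℝ[X]).eval x| ≤ G) :
    MomentBound k (M.left j) (M.right j) G ((z - T) j : ℝ[X]).eval := fun q hq => by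
  have hint (g : ℝ → ℝ) (hg : Continuous g) :
      IntervalIntegrable (fun x => g x * q.eval x) volume (M.left j) (M.right j) :=
    (hg.mul q.continuous).intervalIntegrable _ _
  have heq : ∫ x in (M.left j)..(M.right j), ((z - T) j : ℝ[X]).eval x * q.eval x =
      ∫ x in (M.left j)..(M.right j), (W x - (T j : ℝ[X]).eval x) * q.eval x := by
    simp only [Pi.sub_apply, Submodule.coe_sub, eval_sub, sub_mul]
    rw [intervalIntegral.integral_sub (hint _ (z j : ℝ[X]).continuous)
      (hint _ (T j : ℝ[X]).continuous), hz.integral_mul_eq j q hq,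
      ← intervalIntegral.integral_sub (hint _ hW) (hint _ (T j : ℝ[X]).continuous)]
  rw [heq]
  exact MomentBound.of_abs_le (hW.sub (T j : ℝ[X]).continuous) (M.left_lt_right j).le hT q hq

theorem Mesh.IsGaussRadau.abs_flux_sub_le {M : Mesh a b N} {θ : ℝ} {W : ℝ → ℝ} {z : DGSpace N k}
    (hz : M.IsGaussRadau θ W z) (hab : W a = W b) {T : DGSpace N k} {G : ℝ}
    (hT : ∀ j, ∀ x ∈ Set.Icc (M.left j) (M.right j), |W x - (T j : ℝ[X]).eval x| ≤ G)
    (j : Fin N) : |M.flux θ (z - T) j| ≤ (|θ| + |1 - θ|) * G := by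
  have hright := hT j _ (Set.right_mem_Icc.2 (M.left_lt_right j).le)
  have hleft := hT (finRotate N j) _ (Set.left_mem_Icc.2 (M.left_lt_right _).le)
  rw [M.apply_left_finRotate hab] at hleft
  calc |M.flux θ (z - T) j| =
        |θ * (W (M.right j) - M.traceL T j) + (1 - θ) * (W (M.right j) - M.traceR T j)| := by
        have hflux : M.flux θ (z - T) j = M.flux θ z j - M.flux θ T j := by
          simp only [Mesh.flux, Mesh.traceL, Mesh.traceR, Pi.sub_apply, Submodule.coe_sub,
            eval_sub]
          ring
        rw [hflux, hz.flux_eq, Mesh.flux]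
        ring_nf
    _ ≤ |θ| * |W (M.right j) - M.traceL T j| + |1 - θ| * |W (M.right j) - M.traceR T j| := by
        rw [← abs_mul, ← abs_mul]
        exact abs_add_le _ _
    _ ≤ (|θ| + |1 - θ|) * G := by
        rw [add_mul]
        gcongr
        exacts [hright, hleft]

theorem exists_abs_sub_le_of_isGaussRadau (k : ℕ) {θ : ℝ} (hθ : θ ≠ 1 / 2) : ∃ K > 0,
    ∀ {a b : ℝ} {N : ℕ} {M : Mesh a b N} {W : ℝ → ℝ} {z T : DGSpace N k} {G : ℝ},
      M.IsGaussRadau θ W z → Continuous W → W a = W b →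
      (∀ j, ∀ x ∈ Set.Icc (M.left j) (M.right j), |W x - (T j : ℝ[X]).eval x| ≤ G) →
      ∀ j, ∀ x ∈ Set.Icc (M.left j) (M.right j), |W x - (z j : ℝ[X]).eval x| ≤ K * G := by
  obtain ⟨K, hK, hstable⟩ := exists_abs_eval_le_of_abs_flux_le k hθ
  have hθ_sum : 1 ≤ |θ| + |1 - θ| := by simpa using abs_add_le θ (1 - θ)
  refine ⟨1 + K * (|θ| + |1 - θ|), by positivity, fun {a b N M W z T G} hz hW hab hT j x hx => ?_⟩
  have hG : 0 ≤ G := (abs_nonneg _).trans (hT j x hx)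
  have hzT := hstable M (z - T) ((|θ| + |1 - θ|) * G)
    (fun j => (hz.momentBound_sub hW (hT j)).mono (M.left_lt_right j).le
      (le_mul_of_one_le_left hG hθ_sum))
    (hz.abs_flux_sub_le hab hT) j x hx
  calc |W x - (z j : ℝ[X]).eval x| =
        |(W x - (T j : ℝ[X]).eval x) - ((z - T) j : ℝ[X]).eval x| := by simp
    _ ≤ G + K * ((|θ| + |1 - θ|) * G) := (abs_sub _ _).trans (add_le_add (hT j x hx) hzT)
    _ = _ := by ring

end Stability

section Primitive

variable {a b : ℝ} {N k : ℕ}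

/-- The primitive of `v ∈ V_h` that vanishes at `a`. -/
noncomputable def Mesh.primitive (M : Mesh a b N) (v : DGSpace N k) (x : ℝ) : ℝ :=
  ∫ t in a..x, M.toFun v t

theorem Mesh.continuous_primitive (M : Mesh a b N) (v : DGSpace N k) :
    Continuous (M.primitive v) :=
  intervalIntegral.continuous_primitive (M.intervalIntegrable_toFun v) a

theorem Mesh.primitive_left_eq_right (M : Mesh a b N) {v : DGSpace N k} (hv : v ∈ M.Zh k) :
    M.primitive v a = M.primitive v b := by
  rw [Mesh.primitive, Mesh.primitive, intervalIntegral.integral_same, Mesh.mem_Zh.1 hv]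

theorem Mesh.hasDerivAt_primitive (M : Mesh a b N) (v : DGSpace N k) {j : Fin N} {x : ℝ}
    (hx : x ∈ Set.Ioo (M.left j) (M.right j)) :
    HasDerivAt (M.primitive v) ((v j : ℝ[X]).eval x) x := by
  rw [← M.toFun_eq v ⟨hx.1, hx.2.le⟩]
  refine intervalIntegral.integral_hasDerivAt_right (M.intervalIntegrable_toFun v a x)
    ((M.memLp_pw _ 1).aestronglyMeasurable.stronglyMeasurableAtFilter) ?_
  refine (v j : ℝ[X]).continuousAt.congr ?_
  filter_upwards [Ioo_mem_nhds hx.1 hx.2] with y hy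
  exact (M.toFun_eq v ⟨hy.1, hy.2.le⟩).symm

theorem Mesh.integral_primitive_mul_derivative (M : Mesh a b N) (v : DGSpace N k) (j : Fin N)
    (q : ℝ[X]) :
    ∫ x in (M.left j)..(M.right j), M.primitive v x * (derivative q).eval x =
      M.primitive v (M.right j) * q.eval (M.right j) -
        M.primitive v (M.left j) * q.eval (M.left j) -
        ∫ x in (M.left j)..(M.right j), (v j : ℝ[X]).eval x * q.eval x := by
  refine intervalIntegral.integral_mul_deriv_eq_deriv_mul_of_hasDerivAt
    (M.continuous_primitive v).continuousOn q.continuous.continuousOn (fun x hx => ?_)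
    (fun x _ => q.hasDerivAt x) ((v j : ℝ[X]).continuous.intervalIntegrable _ _)
    ((derivative q).continuous.intervalIntegrable _ _)
  rw [min_eq_left (M.left_lt_right j).le, max_eq_right (M.left_lt_right j).le] at hx
  exact M.hasDerivAt_primitive v hx

theorem exists_const_of_finRotate {α : Type*} [Nonempty α] {g : Fin N → α}
    (hg : ∀ j, g (finRotate N j) = g j) : ∃ c, ∀ j, g j = c := by
  obtain _ | n := N
  · exact ⟨Classical.arbitrary α, fun j => j.elim0⟩
  refine ⟨g 0, fun j => ?_⟩
  induction j using Fin.induction with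
  | zero => rfl
  | succ i ih => rw [← ih, ← hg i.castSucc, finRotate_apply, Fin.coeSucc_eq_succ]

theorem Mesh.integral_D_mul (M : Mesh a b N) (θ : ℝ) (z : DGSpace N k) (j : Fin N)
    (q : degreeLT ℝ (k + 1)) :
    ∫ x in (M.left j)..(M.right j), (M.D θ z j : ℝ[X]).eval x * (q : ℝ[X]).eval x =
      M.flux θ z j * (q : ℝ[X]).eval (M.right j) -
        M.flux θ z ((finRotate N).symm j) * (q : ℝ[X]).eval (M.left j) -
        ∫ x in (M.left j)..(M.right j), (z j : ℝ[X]).eval x * (derivative (q : ℝ[X])).eval x := by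
  have hD := M.ip_D θ z (Pi.single j q)
  have hsumL : ∑ i, M.flux θ z i * M.traceL (Pi.single j q) i =
      M.flux θ z j * (q : ℝ[X]).eval (M.right j) := by
    rw [Finset.sum_eq_single j (fun i _ hij => by simp [Mesh.traceL, hij]) (by simp), Mesh.traceL,
      Pi.single_eq_same]
  have hsumR : ∑ i, M.flux θ z i * M.traceR (Pi.single j q) i =
      M.flux θ z ((finRotate N).symm j) * (q : ℝ[X]).eval (M.left j) := by
    rw [← Equiv.sum_comp (finRotate N).symm, Finset.sum_eq_single j
      (fun i _ hij => by simp [Mesh.traceR, -finRotate_symm_apply, hij]) (by simp), Mesh.traceR,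
      Equiv.apply_symm_apply, Pi.single_eq_same]
  simp only [Mesh.jump, mul_sub, Finset.sum_sub_distrib, hsumL, hsumR] at hD
  rw [M.ip_toFun_single, M.ip_derivFun_single, M.integral_toFun_mul, M.integral_toFun_mul] at hD
  linarith

theorem Mesh.exists_isGaussRadau_primitive (M : Mesh a b N) (θ : ℝ) (z : DGSpace N k) :
    ∃ c, M.IsGaussRadau θ (fun x => c + M.primitive (M.D θ z) x) z := by
  set U := M.primitive (M.D θ z)
  have hUc : Continuous U := M.continuous_primitive _
  have hU (j) : U (M.left j) = U (M.right ((finRotate N).symm j)) := by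
    simpa only [Equiv.apply_symm_apply] using
      M.apply_left_finRotate (M.primitive_left_eq_right (M.D_mem_Zh θ z)) ((finRotate N).symm j)
  have hparts (j) (q : ℝ[X]) (hq : q ∈ degreeLT ℝ (k + 1)) :
      ∫ x in (M.left j)..(M.right j), (z j : ℝ[X]).eval x * (derivative q).eval x =
        (∫ x in (M.left j)..(M.right j), U x * (derivative q).eval x) +
          ((M.flux θ z j - U (M.right j)) * q.eval (M.right j) -
            (M.flux θ z ((finRotate N).symm j) - U (M.right ((finRotate N).symm j))) *
              q.eval (M.left j)) := by
    linear_combination M.integral_D_mul θ z j ⟨q, hq⟩ -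
      M.integral_primitive_mul_derivative (M.D θ z) j q + q.eval (M.left j) * hU j
  obtain ⟨c, hc⟩ := exists_const_of_finRotate (g := fun j => M.flux θ z j - U (M.right j))
    fun j => by
      have hone := hparts (finRotate N j) 1 (one_mem_degreeLT ℝ k)
      simp only [derivative_one, eval_zero, mul_zero, intervalIntegral.integral_zero, eval_one,
        mul_one, zero_add, Equiv.symm_apply_apply] at hone
      exact sub_eq_zero.1 hone.symm
  refine ⟨c, fun j p hp => ?_, fun j => sub_eq_iff_eq_add.1 (hc j)⟩
  obtain ⟨q, hq, rfl⟩ := exists_derivative_eq hp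
  have hint : ∫ x in (M.left j)..(M.right j), (derivative q).eval x =
      q.eval (M.right j) - q.eval (M.left j) :=
    intervalIntegral.integral_eq_sub_of_hasDerivAt (fun x _ => q.hasDerivAt x)
      ((derivative q).continuous.intervalIntegrable _ _)
  simp only [add_mul]
  rw [hparts j q hq, hc, hc, intervalIntegral.integral_add
    (Continuous.intervalIntegrable (by fun_prop) _ _)
    (Continuous.intervalIntegrable (by fun_prop) _ _),
    intervalIntegral.integral_const_mul, hint]
  ring

end Primitive

section Inverse

variable {a b : ℝ} {N k : ℕ} {θ : ℝ}

theorem Mesh.abs_sub_sub_primitive_le (M : Mesh a b N) {f : ℝ → ℝ} (hf : ContDiff ℝ 1 f)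
    (v : DGSpace N k) {x : ℝ} (hx : x ∈ Set.Icc a b) :
    |f x - f a - M.primitive v x| ≤ ∫ t in a..b, |deriv f t - M.toFun v t| := by
  have hf' (x y : ℝ) : IntervalIntegrable (deriv f) volume x y :=
    hf.continuous_deriv_one.intervalIntegrable x y
  rw [Mesh.primitive, ← intervalIntegral.integral_deriv_of_contDiffOn_uIcc hf.contDiffOn,
    ← intervalIntegral.integral_sub (hf' a x) (M.intervalIntegrable_toFun v a x)]
  exact abs_integral_le_integral_abs_of_mem ((hf' a b).sub (M.intervalIntegrable_toFun v a b))
    (Set.left_mem_Icc.2 M.le) hx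

theorem exists_abs_sub_toFun_le_integral_deriv_sub_D (k : ℕ) (hθ : θ ≠ 1 / 2) : ∃ K > 0,
    ∀ {a b : ℝ} {N : ℕ} {M : Mesh a b N} {f : ℝ → ℝ} {z T : DGSpace N k} {G : ℝ},
      ContDiff ℝ 1 f → ∫ x in a..b, f x = 0 → z ∈ M.Zh k →
      (∀ j, ∀ x ∈ Set.Icc (M.left j) (M.right j), |f x - (T j : ℝ[X]).eval x| ≤ G) →
      ∀ x ∈ Set.Ioc a b,
        |f x - M.toFun z x| ≤ K * ((∫ t in a..b, |deriv f t - M.toFun (M.D θ z) t|) + G) := by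
  obtain ⟨K, hK, hstable⟩ := exists_abs_sub_le_of_isGaussRadau k hθ
  refine ⟨2 * (1 + K), by positivity, fun {a b N M f z T G} hf hmean hz hT x hx => ?_⟩
  obtain ⟨c, hradau⟩ := M.exists_isGaussRadau_primitive θ z
  set U := M.primitive (M.D θ z)
  set E := ∫ t in a..b, |deriv f t - M.toFun (M.D θ z) t|
  have hU (y : ℝ) (hy : y ∈ Set.Icc a b) : |f y - f a - U y| ≤ E :=
    M.abs_sub_sub_primitive_le hf _ hy
  have hT' (j) (y : ℝ) (hy : y ∈ Set.Icc (M.left j) (M.right j)) :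
      |c + U y - ((T - (f a - c) • oneDG N k) j : ℝ[X]).eval y| ≤ E + G := by
    calc _ = |(f y - (T j : ℝ[X]).eval y) - (f y - f a - U y)| := by
          simp only [oneDG, Pi.sub_apply, Pi.smul_apply, Submodule.coe_sub, Submodule.coe_smul,
            eval_sub, eval_smul, eval_one, smul_eq_mul]
          ring_nf
      _ ≤ G + E := (abs_sub _ _).trans (add_le_add (hT j y hy) (hU y (M.cell_subset j hy)))
      _ = E + G := add_comm G E
  have hshift (y : ℝ) (hy : y ∈ Set.Ioc a b) :
      |f y - M.toFun z y - (f a - c)| ≤ (1 + K) * (E + G) := by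
    obtain ⟨j, hj⟩ := M.exists_mem_cell hy
    have hyj := Set.Ioc_subset_Icc_self hj
    have hG : 0 ≤ G := (abs_nonneg _).trans (hT j y hyj)
    have hzU := hstable hradau (continuous_const.add (M.continuous_primitive _))
      (congrArg (c + ·) (M.primitive_left_eq_right (M.D_mem_Zh θ z))) hT' j y hyj
    calc _ = |(f y - f a - U y) + (c + U y - (z j : ℝ[X]).eval y)| := by
          rw [M.toFun_eq z hj]
          ring_nf
      _ ≤ E + K * (E + G) := (abs_add_le _ _).trans (add_le_add (hU y (M.cell_subset j hyj)) hzU)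
      _ ≤ (1 + K) * (E + G) := by linarith
  rw [mul_assoc]
  refine abs_le_two_mul_of_integral_eq_zero (f := fun y => f y - M.toFun z y)
    ((hf.continuous.intervalIntegrable a b).sub (M.intervalIntegrable_toFun z a b)) ?_ hshift hx
  rw [intervalIntegral.integral_sub (hf.continuous.intervalIntegrable a b)
    (M.intervalIntegrable_toFun z a b), hmean, Mesh.mem_Zh.1 hz, sub_zero]

theorem Mesh.toFun_zero (M : Mesh a b N) : M.toFun (0 : DGSpace N k) = 0 := by
  ext x
  simp [Mesh.toFun, Mesh.pw]

theorem Mesh.eq_zero_of_D_eq_zero {M : Mesh a b N} (hθ : θ ≠ 1 / 2) {z : DGSpace N k}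
    (hz : z ∈ M.Zh k) (hD : M.D θ z = 0) : z = 0 := by
  obtain ⟨K, -, hbound⟩ := exists_abs_sub_toFun_le_integral_deriv_sub_D k hθ
  have hzero (x : ℝ) (hx : x ∈ Set.Ioc a b) : M.toFun z x = 0 := by
    simpa [hD, M.toFun_zero] using
      hbound (f := 0) (T := 0) (G := 0) contDiff_const (by simp) hz (by simp) x hx
  refine M.eq_zero_of_ip_self z (intervalIntegral.integral_zero_ae (ae_of_all _ fun x hx => ?_))
  rw [Set.uIoc_of_le M.le] at hx
  rw [hzero x hx, mul_zero]

theorem Mesh.bijOn_D (M : Mesh a b N) (k : ℕ) (hθ : θ ≠ 1 / 2) :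
    Set.BijOn (M.D θ) (M.Zh k) (M.Zh k) := by
  have : Module.Finite ℝ (degreeLT ℝ (k + 1)) :=
    Module.Finite.equiv (degreeLTEquiv ℝ (k + 1)).symm
  have hinj : Set.InjOn (M.linearD k θ) (M.submoduleZh k) := fun z hz y hy hzy => by
    refine sub_eq_zero.1 (Mesh.eq_zero_of_D_eq_zero (M := M) hθ ?_ ?_)
    · rw [← M.coe_submoduleZh]
      exact (M.submoduleZh k).sub_mem hz hy
    · exact (map_sub (M.linearD k θ) z y).trans (sub_eq_zero.2 hzy)
  have hmaps : ∀ z ∈ M.submoduleZh k, M.linearD k θ z ∈ M.submoduleZh k := fun z _ =>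
    (M.coe_submoduleZh k).ge (M.D_mem_Zh θ z)
  have hsurj := (LinearMap.injOn_iff_surjOn hmaps).1 hinj
  rw [M.coe_submoduleZh] at hinj hsurj
  exact ⟨fun z _ => M.D_mem_Zh θ z, hinj, hsurj⟩

theorem Mesh.Dinv_mem_Zh (M : Mesh a b N) (hθ : θ ≠ 1 / 2) {z : DGSpace N k} (hz : z ∈ M.Zh k) :
    M.Dinv θ z ∈ M.Zh k :=
  Function.invFunOn_mem ((M.bijOn_D k hθ).surjOn hz)

theorem Mesh.D_Dinv (M : Mesh a b N) (hθ : θ ≠ 1 / 2) {z : DGSpace N k} (hz : z ∈ M.Zh k) :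
    M.D θ (M.Dinv θ z) = z :=
  Function.invFunOn_eq ((M.bijOn_D k hθ).surjOn hz)

theorem Mesh.DinvIter_mem_Zh (M : Mesh a b N) {θ : ℕ → ℝ} {i : ℕ}
    (hθ : ∀ j, 1 ≤ j → j ≤ i → θ j ≠ 1 / 2) {z : DGSpace N k} (hz : z ∈ M.Zh k) :
    M.DinvIter θ i z ∈ M.Zh k := by
  induction i with
  | zero => exact hz
  | succ i ih =>
    exact M.Dinv_mem_Zh (hθ (i + 1) (by omega) le_rfl) (ih fun j hj hji => hθ j hj (by omega))

end Inverse

section Projection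

variable {a b : ℝ} {N k : ℕ}

theorem Mesh.l2norm_sub_proj_apply_le (M : Mesh a b N) {f : ℝ → ℝ} (hf : Continuous f) (j : Fin N)
    (q : degreeLT ℝ (k + 1)) :
    l2norm (M.left j) (M.right j) (fun x => f x - (M.proj k f j : ℝ[X]).eval x) ≤
      l2norm (M.left j) (M.right j) (fun x => f x - (q : ℝ[X]).eval x) := by
  have hP := (M.proj k f j : ℝ[X]).continuous
  have hq := (q : ℝ[X]).continuous
  refine Real.sqrt_le_sqrt (ip_sub_self_le_of_orthogonal (M.left_lt_right j).le hf hP hq ?_)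
  have horth := M.integral_proj_mul hf j (M.proj k f j - q)
  simp only [Submodule.coe_sub, eval_sub] at horth
  simp only [sub_mul]
  rw [intervalIntegral.integral_sub (Continuous.intervalIntegrable (by fun_prop) _ _)
    (Continuous.intervalIntegrable (by fun_prop) _ _), horth, sub_self]

theorem Mesh.l2norm_sub_proj_apply_le_pow_mul (M : Mesh a b N) {f : ℝ → ℝ}
    (hf : ContDiff ℝ (k + 1 : ℕ) f) (j : Fin N) :
    l2norm (M.left j) (M.right j) (fun x => f x - (M.proj k f j : ℝ[X]).eval x) ≤
      M.h ^ (k + 1) * l2norm (M.left j) (M.right j) (iteratedDeriv (k + 1) f) := by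
  obtain ⟨T, hT, hfT⟩ := exists_mem_degreeLT_abs_sub_eval_le hf (M.left j) (M.right j)
  have hle := (M.left_lt_right j).le
  set l := M.left j
  set r := M.right j
  set g := iteratedDeriv (k + 1) f
  have hd : 0 ≤ r - l := sub_nonneg.2 hle
  have hg : Continuous g := hf.continuous_iteratedDeriv (k + 1) le_rfl
  calc _ ≤ l2norm l r (fun x => f x - T.eval x) :=
        M.l2norm_sub_proj_apply_le hf.continuous j ⟨T, hT⟩
    _ ≤ √(r - l) * ((r - l) ^ k * ∫ t in l..r, |g t|) :=
        l2norm_le_of_abs_le hle fun x hx => hfT x (Set.Ioc_subset_Icc_self hx)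
    _ ≤ √(r - l) * ((r - l) ^ k * (√(r - l) * l2norm l r g)) := by
        gcongr
        exact integral_abs_le_l2norm hle (memLp_of_continuous hg 2 l r)
    _ = (r - l) ^ (k + 1) * l2norm l r g := by
        linear_combination (r - l) ^ k * l2norm l r g * Real.mul_self_sqrt hd
    _ ≤ M.h ^ (k + 1) * l2norm l r g := by
        gcongr
        · exact Real.sqrt_nonneg _
        · exact M.cellLength_le_h j

theorem Mesh.l2norm_sub_proj_le (M : Mesh a b N) {f : ℝ → ℝ} (hf : ContDiff ℝ (k + 1 : ℕ) f) :
    l2norm a b (fun x => f x - M.toFun (M.proj k f) x) ≤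
      M.h ^ (k + 1) * l2norm a b (iteratedDeriv (k + 1) f) := by
  have hg : Continuous (iteratedDeriv (k + 1) f) := hf.continuous_iteratedDeriv (k + 1) le_rfl
  set P := M.proj k f
  have hcell (j : Fin N) : Set.EqOn
      (fun x => (f x - (P j : ℝ[X]).eval x) * (f x - (P j : ℝ[X]).eval x))
      (fun x => (f x - M.toFun P x) * (f x - M.toFun P x)) (Set.uIoc (M.left j) (M.right j)) :=
    fun x hx => by
      rw [Set.uIoc_of_le (M.left_lt_right j).le] at hx
      simp only [M.toFun_eq P hx]
  have hh := pow_nonneg M.h_nonneg (k + 1)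
  refine Real.sqrt_le_iff.2 ⟨mul_nonneg hh (Real.sqrt_nonneg _), ?_⟩
  rw [mul_pow, l2norm, Real.sq_sqrt (ip_self_nonneg M.le _), ip, ip, M.integral_eq_sum,
    M.integral_eq_sum, Finset.mul_sum]
  · refine Finset.sum_le_sum fun j _ => ?_
    have hle := (M.left_lt_right j).le
    rw [← intervalIntegral.integral_congr_ae (ae_of_all _ fun x hx => hcell j hx)]
    have hsq := pow_le_pow_left₀ (Real.sqrt_nonneg _) (M.l2norm_sub_proj_apply_le_pow_mul hf j) 2
    rwa [mul_pow, l2norm, Real.sq_sqrt (ip_self_nonneg hle _),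
      Real.sq_sqrt (ip_self_nonneg hle _)] at hsq
  · exact fun j => (hg.mul hg).intervalIntegrable _ _
  · have hfc := hf.continuous
    exact fun j => IntervalIntegrable.congr (hcell j)
      (Continuous.intervalIntegrable (by fun_prop) _ _)

end Projection

section Convergence

variable {a b : ℝ} {N k : ℕ} {f : ℝ → ℝ}

theorem l2norm_iteratedDeriv_le_sobolevNorm (hab : a ≤ b) (f : ℝ → ℝ) {l m : ℕ} (hl : l ≤ m) :
    l2norm a b (iteratedDeriv l f) ≤ sobolevNorm a b m f :=
  Real.sqrt_le_sqrt <| Finset.single_le_sum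
    (f := fun l => ip a b (iteratedDeriv l f) (iteratedDeriv l f)) (fun _ _ => ip_self_nonneg hab _)
    (Finset.mem_range_succ_iff.2 hl)

theorem sobolevNorm_deriv_le (hab : a ≤ b) (f : ℝ → ℝ) (m : ℕ) :
    sobolevNorm a b m (deriv f) ≤ sobolevNorm a b (m + 1) f := by
  refine Real.sqrt_le_sqrt ?_
  simp only [← iteratedDeriv_succ']
  rw [Finset.sum_range_succ' _ (m + 1)]
  exact le_add_of_nonneg_right (ip_self_nonneg hab _)

theorem Mesh.exists_forall_abs_sub_eval_le_of_periodic (M : Mesh a b N) (hab : a < b)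
    (hf : ContDiff ℝ (k + 2 : ℕ) f) (hper : Function.Periodic f (b - a)) :
    ∃ T : DGSpace N k, ∀ j, ∀ x ∈ Set.Icc (M.left j) (M.right j),
      |f x - (T j : ℝ[X]).eval x| ≤ M.h ^ (k + 1) * ∫ t in a..b, |iteratedDeriv (k + 2) f t| := by
  have hf' : ContDiff ℝ (k + 1 : ℕ) f := hf.of_le (Nat.cast_le.2 (by omega))
  choose T hT hfT using fun j => exists_mem_degreeLT_abs_sub_eval_le hf' (M.left j) (M.right j)
  refine ⟨fun j => ⟨T j, hT j⟩, fun j x hx => (hfT j x hx).trans ?_⟩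
  set S := ∫ t in a..b, |iteratedDeriv (k + 2) f t|
  have hd : 0 ≤ M.right j - M.left j := sub_nonneg.2 (M.left_lt_right j).le
  have hS : 0 ≤ S := intervalIntegral.integral_nonneg hab.le fun _ _ => abs_nonneg _
  have hint : ∫ t in (M.left j)..(M.right j), |iteratedDeriv (k + 1) f t| ≤
      S * (M.right j - M.left j) := by
    have hnorm := intervalIntegral.norm_integral_le_of_norm_le_const (C := S)
      (f := fun t => |iteratedDeriv (k + 1) f t|) (a := M.left j) (b := M.right j) fun t ht => by
        rw [Set.uIoc_of_le (M.left_lt_right j).le] at ht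
        rw [norm_abs_eq_norm]
        exact abs_iteratedDeriv_le_integral_abs_of_periodic hab hf hper
          (M.cell_subset j (Set.Ioc_subset_Icc_self ht))
    rw [abs_of_nonneg hd] at hnorm
    exact (le_abs_self _).trans hnorm
  calc _ ≤ (M.right j - M.left j) ^ k * (S * (M.right j - M.left j)) := by gcongr
    _ = (M.right j - M.left j) ^ (k + 1) * S := by ring
    _ ≤ M.h ^ (k + 1) * S := by
        gcongr
        exact M.cellLength_le_h j

theorem exists_l2norm_sub_le_l2norm_deriv_sub_D (k : ℕ) (hab : a < b) {θ : ℝ}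
    (hθ : θ ≠ 1 / 2) : ∃ K > 0, ∀ {N : ℕ} (M : Mesh a b N) {z : DGSpace N k} {f : ℝ → ℝ},
      ContDiff ℝ (k + 2 : ℕ) f → Function.Periodic f (b - a) → ∫ x in a..b, f x = 0 → z ∈ M.Zh k →
      l2norm a b (fun x => f x - M.toFun z x) ≤
        K * (l2norm a b (fun x => deriv f x - M.toFun (M.D θ z) x) +
          M.h ^ (k + 1) * l2norm a b (iteratedDeriv (k + 2) f)) := by
  obtain ⟨K, hK, hbound⟩ := exists_abs_sub_toFun_le_integral_deriv_sub_D k hθ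
  have hd : 0 < b - a := sub_pos.2 hab
  refine ⟨K * (b - a), by positivity, fun {N} M z f hf hper hmean hz => ?_⟩
  have hf1 : ContDiff ℝ 1 f := hf.of_le (by exact_mod_cast Nat.le_add_left 1 (k + 1))
  obtain ⟨T, hT⟩ := M.exists_forall_abs_sub_eval_le_of_periodic hab hf hper
  set e := fun x => deriv f x - M.toFun (M.D θ z) x
  set g := iteratedDeriv (k + 2) f
  have he : ∫ t in a..b, |e t| ≤ √(b - a) * l2norm a b e := integral_abs_le_l2norm hab.le
    ((memLp_of_continuous hf1.continuous_deriv_one 2 a b).sub ((M.memLp_pw _ 2).restrict _))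
  have hg : ∫ t in a..b, |g t| ≤ √(b - a) * l2norm a b g := integral_abs_le_l2norm hab.le
    (memLp_of_continuous (hf.continuous_iteratedDeriv (k + 2) le_rfl) 2 a b)
  have hh := M.h_nonneg
  calc _ ≤ √(b - a) * (K * ((∫ t in a..b, |e t|) + M.h ^ (k + 1) * ∫ t in a..b, |g t|)) :=
        l2norm_le_of_abs_le hab.le (hbound hf1 hmean hz hT)
    _ ≤ √(b - a) * (K * (√(b - a) * l2norm a b e +
          M.h ^ (k + 1) * (√(b - a) * l2norm a b g))) := by gcongr
    _ = K * (b - a) * (l2norm a b e + M.h ^ (k + 1) * l2norm a b g) := by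
        linear_combination K * (l2norm a b e + M.h ^ (k + 1) * l2norm a b g) *
          Real.mul_self_sqrt hd.le

theorem exists_l2norm_sub_DinvIter_le (k : ℕ) (hab : a < b) {θ : ℕ → ℝ} {i : ℕ}
    (hθ : ∀ j, 1 ≤ j → j ≤ i → θ j ≠ 1 / 2) : ∃ C > 0,
    ∀ {N : ℕ} (M : Mesh a b N) {f : ℝ → ℝ}, ContDiff ℝ (k + 1 + i : ℕ) f →
      Function.Periodic f (b - a) → ∫ x in a..b, f x = 0 →
      l2norm a b (fun x => f x - M.toFun (M.DinvIter θ i (M.proj k (iteratedDeriv i f))) x) ≤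
        C * sobolevNorm a b (k + 1 + i) f * M.h ^ (k + 1) := by
  induction i with
  | zero =>
    refine ⟨1, one_pos, fun {N} M f hf _ _ => (M.l2norm_sub_proj_le hf).trans ?_⟩
    rw [one_mul, mul_comm]
    exact mul_le_mul_of_nonneg_right (l2norm_iteratedDeriv_le_sobolevNorm hab.le f le_rfl)
      (pow_nonneg M.h_nonneg _)
  | succ i ih =>
    obtain ⟨C, hC, hind⟩ := ih fun j hj hji => hθ j hj (by omega)
    have hθi := hθ (i + 1) (by omega) le_rfl
    obtain ⟨K, hK, hstep⟩ := exists_l2norm_sub_le_l2norm_deriv_sub_D k hab hθi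
    refine ⟨K * (C + 1), by positivity, fun {N} M f hf hper hmean => ?_⟩
    have hf' : ContDiff ℝ (k + 1 + i : ℕ) (deriv f) := ContDiff.deriv' (by exact_mod_cast hf)
    have hf1 : ContDiff ℝ 1 f := hf.of_le (by exact_mod_cast Nat.le_add_left 1 (k + 1 + i))
    have hmean' := integral_deriv_eq_zero_of_periodic hf1 hper
    set y := M.DinvIter θ i (M.proj k (iteratedDeriv i (deriv f))) with hy
    have hyZ : y ∈ M.Zh k := M.DinvIter_mem_Zh (fun j hj hji => hθ j hj (by omega)) <|
      M.proj_mem_Zh (hf'.continuous_iteratedDeriv i (Nat.cast_le.2 (by omega)))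
        (integral_iteratedDeriv_eq_zero (hf'.of_le (Nat.cast_le.2 (by omega)))
          (periodic_deriv hper) hmean')
    set s := sobolevNorm a b (k + 1 + (i + 1)) f
    have hstep' := hstep M (hf.of_le (Nat.cast_le.2 (by omega))) hper hmean
      (M.Dinv_mem_Zh hθi hyZ)
    rw [M.D_Dinv hθi hyZ] at hstep'
    have hh := M.h_nonneg
    rw [iteratedDeriv_succ', Mesh.DinvIter, ← hy]
    calc _ ≤ _ := hstep'
      _ ≤ K * (C * s * M.h ^ (k + 1) + M.h ^ (k + 1) * s) := by
          gcongr
          · refine (hind M hf' (periodic_deriv hper) hmean').trans ?_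
            gcongr
            exact sobolevNorm_deriv_le hab.le f _
          · exact l2norm_iteratedDeriv_le_sobolevNorm hab.le f (by omega)
      _ = K * (C + 1) * s * M.h ^ (k + 1) := by ring

end Convergence

end PeriodicDG

theorem mainTheorem6_general (a b : ℝ) (hab : a < b) (k i : ℕ) (θ : ℕ → ℝ)
    (hθ : ∀ j, 1 ≤ j → j ≤ i → θ j ≠ 1 / 2) :
    ∃ C : ℝ, 0 < C ∧ ∀ (N : ℕ) (M : PeriodicDG.Mesh a b N),
      (∀ j, 1 ≤ j → j ≤ i → Set.BijOn (M.D (θ j)) (M.Zh k) (M.Zh k)) ∧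
      ∀ w : ℝ → ℝ, ContDiff ℝ ((k + 1 + i : ℕ) : WithTop ℕ∞) w →
        Function.Periodic w (b - a) → (∫ x in a..b, w x) = 0 →
        M.proj k (iteratedDeriv i w) ∈ M.Zh k ∧
        PeriodicDG.l2norm a b
            (fun x => w x - M.toFun (M.DinvIter θ i (M.proj k (iteratedDeriv i w))) x) ≤
          C * PeriodicDG.sobolevNorm a b (k + 1 + i) w * M.h ^ (k + 1) := by
  obtain ⟨C, hC, herror⟩ := PeriodicDG.exists_l2norm_sub_DinvIter_le k hab hθ
  refine ⟨C, hC, fun N M => ⟨fun j hj hji => M.bijOn_D k (hθ j hj hji), fun w hw hper hmean => ?_⟩⟩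
  have hwi : ContDiff ℝ i w := hw.of_le (Nat.cast_le.2 (Nat.le_add_left i (k + 1)))
  exact ⟨M.proj_mem_Zh (hwi.continuous_iteratedDeriv i le_rfl)
    (PeriodicDG.integral_iteratedDeriv_eq_zero hwi hper hmean), herror M hw hper hmean⟩

theorem mainTheorem6 (a b : ℝ) (hab : a < b) (k i : ℕ) (ν : ℝ) (θ : ℕ → ℝ)
    (hθ : ∀ j, 1 ≤ j → j ≤ i → θ j ≠ 1 / 2) :
    ∃ C : ℝ, 0 < C ∧ ∀ (N : ℕ) (M : PeriodicDG.Mesh a b N), M.QuasiUniform ν →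
      (∀ j, 1 ≤ j → j ≤ i → Set.BijOn (M.D (θ j)) (M.Zh k) (M.Zh k)) ∧
      ∀ w : ℝ → ℝ, ContDiff ℝ ((k + 1 + i : ℕ) : WithTop ℕ∞) w →
        Function.Periodic w (b - a) → (∫ x in a..b, w x) = 0 →
        M.proj k (iteratedDeriv i w) ∈ M.Zh k ∧
        PeriodicDG.l2norm a b
            (fun x => w x - M.toFun (M.DinvIter θ i (M.proj k (iteratedDeriv i w))) x) ≤
          C * PeriodicDG.sobolevNorm a b (k + 1 + i) w * M.h ^ (k + 1) := by
  obtain ⟨C, hC, hM⟩ := mainTheorem6_general a b hab k i θ hθ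
  exact ⟨C, hC, fun N M _ => hM N M⟩
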